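/- All graphs are finite and simple. The girth of a graph is the length of a shortest cycle in it. A $(k;g)$-cage is a $k$-regular graph of girth $g$ that has the minimum number of vertices among all $k$-regular graphs of girth $g$. Let $k \ge 3$ be an integer and let $g \ge 5$ be an odd integer. Then every cycle $C$ of length $g$ in a $(k;g)$-cage $G$ is nonseparating; that is, the graph $G - V(C)$, obtained from $G$ by deleting all vertices of $C$, is connected. -/

import Mathlib

namespace SimpleGraph

/-- A `(k; g)`-graph: a `k`-regular graph of girth `g`. The extended girth is used, so that an
acyclic graph (extended girth `⊤`) has no natural number as its girth. -/
def IsRegularGirthGraph {V : Type*} (G : SimpleGraph V) [G.LocallyFinite] (k g : ℕ) : Prop :=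
  G.IsRegularOfDegree k ∧ G.egirth = (g : ℕ∞)

/-- A `(k; g)`-cage: a `(k; g)`-graph of minimum order among all finite `(k; g)`-graphs. Every
finite graph is isomorphic to one with vertex set `Fin n`, where `n` is its order. -/
def IsCage {V : Type*} [Fintype V] (G : SimpleGraph V) [G.LocallyFinite] (k g : ℕ) : Prop :=
  G.IsRegularGirthGraph k g ∧
    ∀ (n : ℕ) (H : SimpleGraph (Fin n)) [H.LocallyFinite],
      H.IsRegularGirthGraph k g → Fintype.card V ≤ n

/-- A closed walk `C` (in the theorem, a cycle) is nonseparating if `G - V(C)` is connected;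
`Connected` includes that some vertex is left. -/
def Walk.IsNonseparating {V : Type*} {G : SimpleGraph V} {u : V} (C : G.Walk u u) : Prop :=
  (G.induce {v : V | v ∉ C.support}).Connected

end SimpleGraph

/-!
# Girth cycles of cages of odd girth are nonseparating

Let `G` be a `(k; g)`-cage with `g = 2 * m + 1`, let `c` be a cycle of length `g`, and let `A` be a
nonempty set of vertices off `c` whose outside neighbours all lie on `c`. The heart of the proof is
that `A` contains at least half of the vertices of `G` (`card_le_of_separated`). If `G - V(c)` were
disconnected, this would apply both to a component and to the union of the other components, which
leaves no vertices for `c`.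

*Minimality.* A cage has minimum order even among the `k`-regular graphs of girth at least `g`
(`card_le_of_isCage`): from a `k`-regular graph of girth larger than `g`, delete a vertex (`k` even)
or the two ends of an edge (`k` odd) and match up the neighbours of each deleted vertex. The result
is smaller, `k`-regular, and its girth dropped by at most one.

*Doubling.* By the girth, every vertex of `A` has at most one neighbour on `c`. Let `Y` be the set
of those that have one. For a permutation `φ` of `Y`, join two copies of `G[A]` by the edges from
`y` in the first copy to `φ y` in the second one. The result is `k`-regular of order `2 * |A|`, and
its girth is at least `g` as soon as `d(y, z) + d(φ y, φ z) + 2 ≥ g` for all `y ≠ z` in `Y`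
(`exists_isReg_of_perm_innerBoundary`). Distances inside `A` are at least `m`, except that `y` and
`z` may be at distance `m - 1` if they are attached to antipodal vertices of `c`. These close pairs
form a relation in which `y` has at most one partner on each of the two antipodes, and going to an
antipode is a rotation of the cycle. So `φ` has to pack a disjoint union of paths and of cycles that
wind around `ZMod g` with itself, which is possible unless the close pairs form a star with one or
two leaves that covers `Y` (`IsLayered.exists_packing_or_star`). If every `y` has a successor under
the rotation, `φ` moves each `y` from layer `i` to layer `2 * i`; otherwise `φ` is built by
induction.

*Stars.* In the exceptional case the centre of the star is deleted from `A` when `m ≥ 3`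
(`card_le_of_boundary_star`), and all of `Y` is deleted when `m = 2`
(`card_le_of_boundary_star_of_girth_five`). The smaller set has a boundary that can be packed, or,
for `m = 2`, possibly a star again, which is handled by induction.
-/

namespace CageCycle

/-! ### Packing two copies of a cyclically layered partial matching -/

section Packing

variable {Y : Type*} {g : ℕ}

/-- A relation layered over the cycle `ZMod g`: `R` steps from each layer of `c` to the next one
and matches every element with at most one successor and at most one predecessor. -/
structure IsLayered (c : Y → ZMod g) (R : Y → Y → Prop) : Prop where
  step : ∀ x y, R x y → c y = c x + 1
  right_unique : ∀ x y z, R x y → R x z → y = z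
  left_unique : ∀ x y z, R x z → R y z → x = y

/-- The permutation `φ` sends no `R`-related pair to an `R`-related pair, in either order. -/
def IsPacking (R : Y → Y → Prop) (φ : Equiv.Perm Y) : Prop :=
  ∀ x y, R x y → ¬ R (φ x) (φ y) ∧ ¬ R (φ y) (φ x)

/-- `e` is the centre of a star: it has an `R`-neighbour, and everything else is an
`R`-neighbour of it. -/
def IsStarCentre (R : Y → Y → Prop) (e : Y) : Prop :=
  (∃ y, y ≠ e ∧ (R e y ∨ R y e)) ∧ ∀ y, y ≠ e → R e y ∨ R y e

lemma natCast_ne_zero_of_lt (hg : 5 ≤ g) {j : ℕ} (h0 : j ≠ 0) (hj : j < 5) :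
    (j : ZMod g) ≠ 0 := by
  intro h
  rw [ZMod.natCast_eq_zero_iff] at h
  exact absurd (Nat.le_of_dvd (Nat.pos_of_ne_zero h0) h) (by omega)

lemma IsLayered.not_symm (hg : 5 ≤ g) {c : Y → ZMod g} {R : Y → Y → Prop}
    (h : IsLayered c R) {x y : Y} (hxy : R x y) : ¬ R y x := by
  intro hyx
  have h1 := h.step _ _ hxy
  have h2 := h.step _ _ hyx
  apply natCast_ne_zero_of_lt hg (j := 2) (by norm_num) (by norm_num)
  push_cast
  linear_combination -h1 - h2

lemma IsLayered.irrefl (hg : 5 ≤ g) {c : Y → ZMod g} {R : Y → Y → Prop}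
    (h : IsLayered c R) (x : Y) : ¬ R x x := fun hx => h.not_symm hg hx hx

lemma IsLayered.not_triangle (hg : 5 ≤ g) {c : Y → ZMod g} {R : Y → Y → Prop}
    (h : IsLayered c R) {x y z : Y} (hxy : R x y ∨ R y x) (hyz : R y z ∨ R z y)
    (hzx : R z x ∨ R x z) : False := by
  have n1 := natCast_ne_zero_of_lt hg (j := 1) (by norm_num) (by norm_num)
  have n3 := natCast_ne_zero_of_lt hg (j := 3) (by norm_num) (by norm_num)
  push_cast at n1 n3
  rcases hxy with a | a <;> rcases hyz with b | b <;> rcases hzx with d | d <;>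
    have ha := h.step _ _ a <;> have hb := h.step _ _ b <;> have hd := h.step _ _ d
  · exact n3 (by linear_combination -ha - hb - hd)
  · exact n1 (by linear_combination -ha - hb + hd)
  · exact n1 (by linear_combination -ha + hb - hd)
  · exact n1 (by linear_combination ha - hb - hd)
  · exact n1 (by linear_combination ha - hb - hd)
  · exact n1 (by linear_combination -ha + hb - hd)
  · exact n1 (by linear_combination -ha - hb + hd)
  · exact n3 (by linear_combination -ha - hb - hd)

lemma IsLayered.not_square (hg : 5 ≤ g) {c : Y → ZMod g} {R : Y → Y → Prop}
    (h : IsLayered c R) {x y z w : Y} (hxz : x ≠ z) (hyw : y ≠ w)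
    (hxy : R x y ∨ R y x) (hyz : R y z ∨ R z y)
    (hzw : R z w ∨ R w z) (hwx : R w x ∨ R x w) : False := by
  have n4 := natCast_ne_zero_of_lt hg (j := 4) (by norm_num) (by norm_num)
  push_cast at n4
  -- unique successors and predecessors force all four steps to go the same way round
  rcases hxy with a | a
  · have b : R y z := hyz.resolve_right fun b => hxz (h.left_unique _ _ _ a b)
    have d : R z w := hzw.resolve_right fun d => hyw (h.left_unique _ _ _ b d)
    have e : R w x := hwx.resolve_right fun e => hyw (h.right_unique _ _ _ a e)
    have ha := h.step _ _ a
    have hb := h.step _ _ b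
    have hd := h.step _ _ d
    have he := h.step _ _ e
    exact n4 (by linear_combination -ha - hb - hd - he)
  · have b : R z y := hyz.resolve_left fun b => hxz (h.right_unique _ _ _ a b)
    have d : R w z := hzw.resolve_left fun d => hyw (h.right_unique _ _ _ b d)
    have e : R x w := hwx.resolve_left fun e => hyw (h.left_unique _ _ _ a e)
    have ha := h.step _ _ a
    have hb := h.step _ _ b
    have hd := h.step _ _ d
    have he := h.step _ _ e
    exact n4 (by linear_combination -ha - hb - hd - he)

/-- If every element has a successor, `R` is the graph of a permutation `F`. The map
`y ↦ F^[c y] y` then doubles the layer number, so it sends consecutive layers to layers two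
apart. -/
lemma IsLayered.exists_packing_of_total [Finite Y] (hg : 5 ≤ g) (hodd : Odd g)
    {c : Y → ZMod g} {R : Y → Y → Prop} (h : IsLayered c R) (htot : ∀ x, ∃ y, R x y) :
    ∃ φ, IsPacking R φ := by
  have : NeZero g := ⟨by omega⟩
  choose F hF using htot
  have hFinj : Function.Injective F := fun x y hxy =>
    h.left_unique _ _ _ (hF x) (hxy ▸ hF y)
  have hc : ∀ n y, c (F^[n] y) = c y + n := by
    intro n
    induction n with
    | zero => simp
    | succ n ih =>
      intro y
      rw [Function.iterate_succ_apply', h.step _ _ (hF _), ih]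
      push_cast
      ring
  have hc2 : ∀ y, c (F^[(c y).val] y) = 2 * c y := by
    intro y
    rw [hc, ZMod.natCast_zmod_val]
    ring
  have h2 : IsUnit (2 : ZMod g) := by
    have := (ZMod.isUnit_iff_coprime 2 g).2 (Nat.coprime_two_left.2 hodd)
    exact_mod_cast this
  have hinj : Function.Injective fun y => F^[(c y).val] y := by
    intro x y hxy
    have hxy' : F^[(c x).val] x = F^[(c y).val] y := hxy
    have e : c x = c y := by
      have := congrArg c hxy'
      rw [hc2, hc2] at this
      exact h2.mul_left_cancel this
    rw [e] at hxy'
    exact hFinj.iterate _ hxy'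
  refine ⟨Equiv.ofBijective _ (Finite.injective_iff_bijective.1 hinj), fun x y hxy => ?_⟩
  have n1 := natCast_ne_zero_of_lt hg (j := 1) (by norm_num) (by norm_num)
  have n3 := natCast_ne_zero_of_lt hg (j := 3) (by norm_num) (by norm_num)
  push_cast at n1 n3
  have e := h.step _ _ hxy
  constructor <;> intro hR <;> have e' := h.step _ _ hR <;>
    simp only [Equiv.ofBijective_apply, hc2] at e'
  · exact n1 (by linear_combination e' - 2 * e)
  · exact n3 (by linear_combination -e' - 2 * e)

/-- A graph on four vertices without vertices of degree three, triangles and 4-cycles leaves a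
Hamiltonian path in its complement. -/
lemma exists_hamiltonian_nonadj_fin_four (m : Fin 4 → Fin 4 → Prop) (hs : ∀ i j, m i j → m j i)
    (hdeg : ∀ i j k l, j ≠ i → k ≠ i → l ≠ i → j ≠ k → j ≠ l → k ≠ l →
      m i j → m i k → m i l → False)
    (htri : ∀ i j k, m i j → m j k → m k i → False)
    (hsq : ∀ i j k l, i ≠ k → j ≠ l → m i j → m j k → m k l → m l i → False) :
    ∃ p : Fin 4 → Fin 4, Function.Injective p ∧ ¬ m (p 0) (p 2) ∧ ¬ m (p 0) (p 3) ∧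
      ¬ m (p 1) (p 3) := by
  have hinj : ∀ a b d e : Fin 4, a ≠ b → a ≠ d → a ≠ e → b ≠ d → b ≠ e → d ≠ e →
      Function.Injective ![a, b, d, e] := by
    unfold Function.Injective
    decide
  by_contra hcon
  push Not at hcon
  have key : ∀ a b d e : Fin 4, a ≠ b → a ≠ d → a ≠ e → b ≠ d → b ≠ e → d ≠ e →
      ¬ m a d → ¬ m a e → m b e := by
    intro a b d e h1 h2 h3 h4 h5 h6 h7 h8
    exact hcon ![a, b, d, e] (hinj a b d e h1 h2 h3 h4 h5 h6) h7 h8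
  have k (a b d e : Fin 4) (H : a ≠ b ∧ a ≠ d ∧ a ≠ e ∧ b ≠ d ∧ b ≠ e ∧ d ≠ e) :=
    key a b d e H.1 H.2.1 H.2.2.1 H.2.2.2.1 H.2.2.2.2.1 H.2.2.2.2.2
  have s01 : m 1 0 ↔ m 0 1 := ⟨hs _ _, hs _ _⟩
  have s02 : m 2 0 ↔ m 0 2 := ⟨hs _ _, hs _ _⟩
  have s03 : m 3 0 ↔ m 0 3 := ⟨hs _ _, hs _ _⟩
  have s12 : m 2 1 ↔ m 1 2 := ⟨hs _ _, hs _ _⟩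
  have s13 : m 3 1 ↔ m 1 3 := ⟨hs _ _, hs _ _⟩
  have s23 : m 3 2 ↔ m 2 3 := ⟨hs _ _, hs _ _⟩
  have a1 := hdeg 0 1 2 3 (by decide) (by decide) (by decide) (by decide) (by decide) (by decide)
  have a2 := hdeg 1 0 2 3 (by decide) (by decide) (by decide) (by decide) (by decide) (by decide)
  have a3 := hdeg 2 0 1 3 (by decide) (by decide) (by decide) (by decide) (by decide) (by decide)
  have a4 := hdeg 3 0 1 2 (by decide) (by decide) (by decide) (by decide) (by decide) (by decide)
  have t1 := htri 0 1 2
  have t2 := htri 0 1 3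
  have t3 := htri 0 2 3
  have t4 := htri 1 2 3
  have q1 := hsq 0 1 2 3 (by decide) (by decide)
  have q2 := hsq 0 1 3 2 (by decide) (by decide)
  have q3 := hsq 0 2 1 3 (by decide) (by decide)
  have k1 := k 0 1 2 3 (by decide)
  have k2 := k 0 1 3 2 (by decide)
  have k3 := k 0 2 1 3 (by decide)
  have k4 := k 0 2 3 1 (by decide)
  have k5 := k 0 3 1 2 (by decide)
  have k6 := k 0 3 2 1 (by decide)
  have k7 := k 1 0 2 3 (by decide)
  have k8 := k 1 0 3 2 (by decide)
  have k9 := k 1 2 0 3 (by decide)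
  have k10 := k 1 3 0 2 (by decide)
  have k11 := k 2 0 1 3 (by decide)
  have k12 := k 2 1 0 3 (by decide)
  have k13 := k 2 3 0 1 (by decide)
  have k14 := k 2 3 1 0 (by decide)
  have k15 := k 3 2 0 1 (by decide)
  have k16 := k 3 2 1 0 (by decide)
  clear hs hdeg htri hsq hcon key k hinj
  simp only [s01, s02, s03, s12, s13, s23] at *
  clear s01 s02 s03 s12 s13 s23
  grind +splitImp

lemma IsLayered.exists_packing_of_card_eq_four [Fintype Y] (hg : 5 ≤ g)
    {c : Y → ZMod g} {R : Y → Y → Prop} (h : IsLayered c R) (hY : Fintype.card Y = 4) :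
    ∃ φ, IsPacking R φ := by
  let e : Y ≃ Fin 4 := Fintype.equivFinOfCardEq hY
  obtain ⟨p, hp, h02, h03, h13⟩ := exists_hamiltonian_nonadj_fin_four
    (fun i j => R (e.symm i) (e.symm j) ∨ R (e.symm j) (e.symm i)) (fun i j => Or.symm)
    (by
      intro i j k l _ _ _ hjk hjl hkl a b d
      have hjk' := e.symm.injective.ne hjk
      have hjl' := e.symm.injective.ne hjl
      have hkl' := e.symm.injective.ne hkl
      -- two of three neighbours lie on the same side
      rcases a with a | a <;> rcases b with b | b <;> rcases d with d | d <;>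
        first
          | exact hjk' (h.right_unique _ _ _ a b)
          | exact hjk' (h.left_unique _ _ _ a b)
          | exact hjl' (h.right_unique _ _ _ a d)
          | exact hjl' (h.left_unique _ _ _ a d)
          | exact hkl' (h.right_unique _ _ _ b d)
          | exact hkl' (h.left_unique _ _ _ b d))
    (fun i j k a b d => h.not_triangle hg a b d)
    (fun i j k l hik hjl a b d f =>
      h.not_square hg (e.symm.injective.ne hik) (e.symm.injective.ne hjl) a b d f)
  let q : Fin 4 ≃ Y := (Equiv.ofBijective p (Finite.injective_iff_bijective.1 hp)).trans e.symm
  have hq : ∀ i, q i = e.symm (p i) := fun i => rfl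
  -- `0 ↦ 1 ↦ 3 ↦ 2 ↦ 0` sends the path `0 1 2 3` into its complement
  let s : Equiv.Perm (Fin 4) := ⟨![1, 3, 0, 2], ![2, 0, 3, 1], by decide, by decide⟩
  simp only [← hq] at h02 h03 h13
  push Not at h02 h03 h13
  refine ⟨(q.symm.trans s).trans q, fun x y hxy => ?_⟩
  obtain ⟨i, rfl⟩ := q.surjective x
  obtain ⟨j, rfl⟩ := q.surjective y
  have hii := fun i => h.irrefl hg (q i)
  simp only [Equiv.trans_apply, Equiv.symm_apply_apply]
  have v0 : s 0 = 1 := rfl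
  have v1 : s 1 = 3 := rfl
  have v2 : s 2 = 0 := rfl
  have v3 : s 3 = 2 := rfl
  fin_cases i <;> fin_cases j <;> simp_all

/-- Induction on the number of elements. If some `v` has no successor, its only possible neighbour is
its predecessor `t`, and a packing of the other elements extends by fixing `v`, unless it also
fixes `t`; a swap of `v` with a suitable element repairs that case. -/
lemma IsLayered.exists_packing_of_four_le (hg : 5 ≤ g) (hodd : Odd g) (n : ℕ) (hn : 4 ≤ n) :
    ∀ {Y : Type*} [Fintype Y] {c : Y → ZMod g} {R : Y → Y → Prop}, IsLayered c R →
      Fintype.card Y = n → ∃ φ, IsPacking R φ := by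
  classical
  induction n, hn using Nat.le_induction with
  | base => exact fun h hY => h.exists_packing_of_card_eq_four hg hY
  | succ n hn ih =>
    intro Y _ c R h hY
    by_cases htot : ∀ x, ∃ y, R x y
    · exact h.exists_packing_of_total hg hodd htot
    push Not at htot
    obtain ⟨v, hv⟩ := htot
    have h' : IsLayered (fun y : {y // y ≠ v} => c y) (fun x y => R x y) :=
      ⟨fun x y => h.step _ _, fun x y z a b => Subtype.ext (h.right_unique _ _ _ a b),
        fun x y z a b => Subtype.ext (h.left_unique _ _ _ a b)⟩
    obtain ⟨ψ, hψ⟩ := ih h' (by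
      rw [Fintype.card_subtype_compl, hY]; simp)
    let φ : Equiv.Perm Y := Equiv.Perm.ofSubtype ψ
    have hφv : φ v = v := Equiv.Perm.ofSubtype_apply_of_not_mem ψ (by simp)
    have hφ : ∀ x y, x ≠ v → y ≠ v → R x y → ¬ R (φ x) (φ y) ∧ ¬ R (φ y) (φ x) := by
      intro x y hx hy hxy
      have := hψ ⟨x, hx⟩ ⟨y, hy⟩ hxy
      beta_reduce at this
      rwa [← Equiv.Perm.ofSubtype_apply_of_mem ψ hx, ← Equiv.Perm.ofSubtype_apply_of_mem ψ hy]
        at this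
    by_cases hfix : ∃ t, R t v ∧ φ t = t
    · obtain ⟨t, htv, ht⟩ := hfix
      have htne : t ≠ v := fun e => h.irrefl hg v (e ▸ htv)
      -- the only neighbour `t` of `v` is fixed, so `v` is swapped with some `w` that avoids `t`,
      -- the other neighbour of `t`, and its `φ`-preimage
      obtain ⟨w, hwv, hwt, hw1, hw2⟩ : ∃ w, w ≠ v ∧ w ≠ t ∧ ¬ R w t ∧ ¬ R (φ w) t := by
        by_contra hcon
        push Not at hcon
        have : ∃ s : Finset Y, s.card ≤ 4 ∧ ∀ w, w ∈ s := by
          by_cases hs : ∃ s, R s t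
          · obtain ⟨s, hs⟩ := hs
            refine ⟨{v, t, s, φ.symm s}, Finset.card_le_four, fun w => ?_⟩
            by_contra hw
            simp only [Finset.mem_insert, Finset.mem_singleton, not_or] at hw
            have := hcon w hw.1 hw.2.1 fun hR => hw.2.2.1 (h.left_unique _ _ _ hR hs)
            exact hw.2.2.2 (φ.injective (by simpa using h.left_unique _ _ _ this hs))
          · push Not at hs
            refine ⟨{v, t}, Finset.card_le_two.trans (by norm_num), fun w => ?_⟩
            by_contra hw
            simp only [Finset.mem_insert, Finset.mem_singleton, not_or] at hw
            exact hs _ (hcon w hw.1 hw.2 (hs w))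
        obtain ⟨s, hs, hs'⟩ := this
        have := Finset.eq_univ_iff_forall.2 hs'
        rw [this, Finset.card_univ, hY] at hs
        omega
      have hφwv : φ w ≠ v := fun e => hwv (φ.injective (e.trans hφv.symm))
      let θ : Equiv.Perm Y := (Equiv.swap v w).trans φ
      have θv : θ v = φ w := by simp [θ]
      have θw : θ w = v := by simp [θ, hφv]
      have θo : ∀ x, x ≠ v → x ≠ w → θ x = φ x := fun x h1 h2 => by
        simp [θ, Equiv.swap_apply_of_ne_of_ne h1 h2]
      refine ⟨θ, fun x y hxy => ?_⟩
      have hxv : x ≠ v := fun e => hv y (e ▸ hxy)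
      have fixt : ∀ z, R (φ z) v → z = t := fun z hz =>
        φ.injective ((h.left_unique _ _ _ hz htv).trans ht.symm)
      by_cases hyv : y = v
      · subst hyv
        have := h.left_unique _ _ _ hxy htv
        subst this
        rw [θv, θo x hxv (Ne.symm hwt), ht]
        exact ⟨fun hR => hφwv (h.right_unique _ _ _ hR htv), hw2⟩
      by_cases hxw : x = w
      · subst hxw
        have hyx : y ≠ x := fun e => h.irrefl hg _ (e ▸ hxy)
        rw [θw, θo y hyv hyx]
        refine ⟨hv _, fun hR => ?_⟩
        have := fixt _ hR
        subst this
        exact hw1 hxy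
      by_cases hyw : y = w
      · subst hyw
        rw [θw, θo x hxv hxw]
        refine ⟨fun hR => ?_, hv _⟩
        have := fixt _ hR
        subst this
        exact hyv (h.right_unique _ _ _ hxy htv)
      rw [θo x hxv hxw, θo y hyv hyw]
      exact hφ x y hxv hyv hxy
    · push Not at hfix
      refine ⟨φ, fun x y hxy => ?_⟩
      have hxv : x ≠ v := fun e => hv y (e ▸ hxy)
      by_cases hyv : y = v
      · subst hyv
        rw [hφv]
        exact ⟨fun hR => hfix _ hxy (h.left_unique _ _ _ hR hxy), hv _⟩
      · exact hφ x y hxv hyv hxy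

/-- Two copies of a layered partial matching can be packed, unless the matching is a star with one
or two leaves that covers everything. -/
theorem IsLayered.exists_packing_or_star [Fintype Y] (hg : 5 ≤ g) (hodd : Odd g)
    {c : Y → ZMod g} {R : Y → Y → Prop} (h : IsLayered c R) :
    (∃ φ, IsPacking R φ) ∨ (Fintype.card Y ≤ 3 ∧ ∃ e, IsStarCentre R e) := by
  classical
  by_cases hY : 4 ≤ Fintype.card Y
  · exact Or.inl (IsLayered.exists_packing_of_four_le hg hodd _ hY h rfl)
  by_cases hR : ∃ a b, R a b
  · obtain ⟨a, b, hab⟩ := hR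
    have hne : a ≠ b := fun e => h.irrefl hg b (e ▸ hab)
    by_cases ha : IsStarCentre R a
    · exact Or.inr ⟨by omega, a, ha⟩
    by_cases hb : IsStarCentre R b
    · exact Or.inr ⟨by omega, b, hb⟩
    left
    unfold IsStarCentre at ha hb
    push Not at ha hb
    obtain ⟨d, hda, hd1, hd2⟩ := ha ⟨b, hne.symm, Or.inl hab⟩
    obtain ⟨d', hdb', hd3, hd4⟩ := hb ⟨a, hne, Or.inr hab⟩
    have hdb : d ≠ b := fun e => hd1 (e ▸ hab)
    have hda' : d' ≠ a := fun e => hd4 (e ▸ hab)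
    have hall : ∀ y, y = a ∨ y = b ∨ y = d := by
      intro y
      have h3 : ({a, b, d} : Finset Y) = Finset.univ := by
        apply Finset.eq_univ_of_card
        have h1 : ({a, b, d} : Finset Y).card = 3 :=
          Finset.card_eq_three.2 ⟨a, b, d, hne, hda.symm, hdb.symm, rfl⟩
        have h2 := Finset.card_le_univ ({a, b, d} : Finset Y)
        omega
      have := Finset.mem_univ y
      rw [← h3] at this
      simpa using this
    have hdd : d' = d := by
      rcases hall d' with e | e | e
      · exact absurd e hda'
      · exact absurd e hdb'
      · exact e
    subst hdd
    have s1 : Equiv.swap a d' a = d' := Equiv.swap_apply_left _ _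
    have s2 : Equiv.swap a d' b = b := Equiv.swap_apply_of_ne_of_ne hne.symm hdb.symm
    have hba := h.not_symm hg hab
    have hii := h.irrefl hg
    refine ⟨Equiv.swap a d', fun x y hxy => ?_⟩
    rcases hall x with rfl | rfl | rfl <;> rcases hall y with rfl | rfl | rfl <;> simp_all
  · push Not at hR
    exact Or.inl ⟨1, fun x y hxy => absurd hxy (hR x y)⟩

end Packing

open SimpleGraph

/-! ### Girth and walks -/

section Girth

variable {V : Type*} {G : SimpleGraph V} {g : ℕ}

/-- An edge together with a walk between its ends that avoids it contains a cycle. -/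
lemma le_length_add_one_of_notMem_edges (hg : (g : ℕ∞) ≤ G.egirth) {x y : V} (h : G.Adj x y)
    (p : G.Walk y x) (hp : s(x, y) ∉ p.edges) : g ≤ p.length + 1 := by
  classical
  have hcyc : (Walk.cons h p.bypass).IsCycle :=
    (Walk.cons_isCycle_iff _ _).2
      ⟨p.bypass_isPath, fun he => hp (p.edges_bypass_subset_edges he)⟩
  have h1 := hg.trans (egirth_le_length hcyc)
  have h2 := p.length_bypass_le_length
  rw [Walk.length_cons] at h1
  have h3 : g ≤ p.bypass.length + 1 := by exact_mod_cast h1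
  omega

/-- A walk that avoids `v` between two distinct neighbours of `v` has length at least the girth
minus two. -/
lemma le_length_add_two_of_adj (hg : (g : ℕ∞) ≤ G.egirth) {v a b : V} (ha : G.Adj v a)
    (hb : G.Adj v b) (hab : a ≠ b) (p : G.Walk a b) (hp : v ∉ p.support) :
    g ≤ p.length + 2 := by
  have := le_length_add_one_of_notMem_edges hg ha (p.append (.cons hb.symm .nil)) (by
    rw [Walk.edges_append, List.mem_append]
    rintro (h | h)
    · exact hp (p.fst_mem_support_of_mem_edges h)
    · simp only [Walk.edges_cons, Walk.edges_nil, List.mem_singleton] at h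
      rcases Sym2.eq_iff.1 h with e | e
      · exact hb.ne e.1
      · exact hab e.2)
  simpa using this

lemma not_adj_of_adj_of_adj (hg : (g : ℕ∞) ≤ G.egirth) (hg4 : 4 ≤ g) {a b c : V}
    (hab : G.Adj a b) (hac : G.Adj a c) : ¬ G.Adj b c := by
  intro h
  have := le_length_add_two_of_adj hg hab hac h.ne (.cons h .nil)
    (by simp [hab.ne, hac.ne])
  simp at this
  omega

lemma eq_of_common_adj (hg : (g : ℕ∞) ≤ G.egirth) (hg5 : 5 ≤ g) {a b c d : V} (hac : a ≠ c)
    (hab : G.Adj a b) (hbc : G.Adj b c) (hcd : G.Adj c d) (hda : G.Adj d a) : b = d := by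
  by_contra hne
  have := le_length_add_two_of_adj hg hab hda.symm hne (.cons hbc (.cons hcd .nil))
    (by simp [hab.ne, hda.ne', hac])
  simp at this
  omega

variable {W : Type*} {H F : SimpleGraph W}

/-- A walk in `H ⊔ F` either stays in `H` or splits at its first edge of `F`. -/
lemma exists_mapLe_or_exists_first_adj {a b : W} (p : (H ⊔ F).Walk a b) :
    (∃ q : H.Walk a b, p = q.mapLe le_sup_left) ∨
      ∃ (c d : W) (q : H.Walk a c) (h : F.Adj c d) (r : (H ⊔ F).Walk d b),
        p = (q.mapLe le_sup_left).append (.cons (Or.inr h) r) := by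
  induction p with
  | nil => exact Or.inl ⟨.nil, rfl⟩
  | @cons u v w h p ih =>
    rcases h with h | h
    · rcases ih with ⟨q, rfl⟩ | ⟨c, d, q, h', r, rfl⟩
      · exact Or.inl ⟨.cons h q, rfl⟩
      · exact Or.inr ⟨c, d, .cons h q, h', r, rfl⟩
    · exact Or.inr ⟨u, v, .nil, h, p, rfl⟩

/-- Lower bound for the length of a cycle through the edge `cd` of the matching `F` in `H ⊔ F`:
`h1`, `h2` and `h3` treat the closed walks with one, two and three matching edges, and `h4` bounds
each of the segments between matching edges when there are at least four. -/
lemma le_length_add_one_of_matching {t : ℕ}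
    (hF : ∀ a b c, F.Adj a b → F.Adj a c → b = c)
    (h1 : ∀ a b, F.Adj a b → ∀ p : H.Walk b a, t ≤ p.length + 1)
    (h2 : ∀ a b c d, F.Adj a b → F.Adj c d → c ≠ b → c ≠ a →
      ∀ (p : H.Walk b c) (q : H.Walk d a), t ≤ p.length + q.length + 2)
    (h3 : ∀ a b c d e f, F.Adj a b → F.Adj c d → F.Adj e f → c ≠ b → e ≠ d →
      ∀ (p : H.Walk b c) (q : H.Walk d e) (r : H.Walk f a),
        t ≤ p.length + q.length + r.length + 3)
    (h4 : ∀ a b c d, F.Adj a b → F.Adj c d → b ≠ c →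
      ∀ p : H.Walk b c, t ≤ 4 * p.length + 4)
    {c d : W} (h : F.Adj c d) (w : (H ⊔ F).Walk d c) (hw : w.IsTrail) (he : s(c, d) ∉ w.edges) :
    t ≤ w.length + 1 := by
  rcases exists_mapLe_or_exists_first_adj w with ⟨q, rfl⟩ | ⟨c₁, d₁, q₁, hh1, w₁, rfl⟩
  · simpa using h1 _ _ h q
  have hc1d : c₁ ≠ d := by
    rintro rfl
    have := hF _ _ _ h.symm hh1
    subst this
    exact he (by simp [Sym2.eq_swap])
  have hc1c : c₁ ≠ c := by
    rintro rfl
    have := hF _ _ _ h hh1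
    subst this
    exact he (by simp)
  replace hw := hw.of_append_right
  simp only [Walk.edges_append, List.mem_append, not_or, Walk.edges_cons, List.mem_cons] at he
  replace he := he.2.2
  rw [Walk.isTrail_cons] at hw
  obtain ⟨hw, he1⟩ := hw
  simp only [Walk.length_append, Walk.length_cons, Walk.length_map]
  rcases exists_mapLe_or_exists_first_adj w₁ with ⟨q, rfl⟩ | ⟨c₂, d₂, q₂, hh2, w₂, rfl⟩
  · have := h2 _ _ _ _ h hh1 hc1d hc1c q₁ q
    simp only [Walk.length_map]
    omega
  have hc2d1 : c₂ ≠ d₁ := by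
    rintro rfl
    have := hF _ _ _ hh1.symm hh2
    subst this
    exact he1 (by simp [Sym2.eq_swap])
  replace hw := hw.of_append_right
  simp only [Walk.edges_append, List.mem_append, not_or, Walk.edges_cons, List.mem_cons] at he
  replace he := he.2.2
  rw [Walk.isTrail_cons] at hw
  obtain ⟨hw, he2⟩ := hw
  simp only [Walk.length_append, Walk.length_cons, Walk.length_map]
  rcases exists_mapLe_or_exists_first_adj w₂ with ⟨q, rfl⟩ | ⟨c₃, d₃, q₃, hh3, w₃, rfl⟩
  · have := h3 _ _ _ _ _ _ h hh1 hh2 hc1d hc2d1 q₁ q₂ q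
    simp only [Walk.length_map]
    omega
  have hc3d2 : c₃ ≠ d₂ := by
    rintro rfl
    have := hF _ _ _ hh2.symm hh3
    subst this
    exact he2 (by simp [Sym2.eq_swap])
  simp only [Walk.length_append, Walk.length_cons, Walk.length_map]
  have b1 := h4 _ _ _ _ h hh1 hc1d.symm q₁
  have b2 := h4 _ _ _ _ hh1 hh2 hc2d1.symm q₂
  have b3 := h4 _ _ _ _ hh2 hh3 hc3d2.symm q₃
  have hd3 : d₃ ≠ c := by
    rintro rfl
    have := hF _ _ _ h hh3.symm
    subst this
    exact he (by simp [Sym2.eq_swap])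
  replace hw := hw.of_append_right
  rw [Walk.isTrail_cons] at hw
  obtain ⟨hw, he3⟩ := hw
  rcases exists_mapLe_or_exists_first_adj w₃ with ⟨q, rfl⟩ | ⟨c₄, d₄, q₄, hh4, w₄, rfl⟩
  · have b4 := h4 _ _ _ _ hh3 h hd3 q
    simp only [Walk.length_map]
    omega
  have hc4d3 : c₄ ≠ d₃ := by
    rintro rfl
    have := hF _ _ _ hh3.symm hh4
    subst this
    exact he3 (by simp [Sym2.eq_swap])
  have b4 := h4 _ _ _ _ hh3 hh4 hc4d3.symm q₄
  simp only [Walk.length_append, Walk.length_cons, Walk.length_map]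
  omega

/-- Lower bound for the girth of a graph `H` with an added matching `F`; the hypotheses are those
of `le_length_add_one_of_matching`. -/
theorem le_egirth_sup_of_matching {t : ℕ} (h0 : (t : ℕ∞) ≤ H.egirth)
    (hF : ∀ a b c, F.Adj a b → F.Adj a c → b = c)
    (h1 : ∀ a b, F.Adj a b → ∀ p : H.Walk b a, t ≤ p.length + 1)
    (h2 : ∀ a b c d, F.Adj a b → F.Adj c d → c ≠ b → c ≠ a →
      ∀ (p : H.Walk b c) (q : H.Walk d a), t ≤ p.length + q.length + 2)
    (h3 : ∀ a b c d e f, F.Adj a b → F.Adj c d → F.Adj e f → c ≠ b → e ≠ d →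
      ∀ (p : H.Walk b c) (q : H.Walk d e) (r : H.Walk f a),
        t ≤ p.length + q.length + r.length + 3)
    (h4 : ∀ a b c d, F.Adj a b → F.Adj c d → b ≠ c →
      ∀ p : H.Walk b c, t ≤ 4 * p.length + 4) :
    (t : ℕ∞) ≤ (H ⊔ F).egirth := by
  rw [le_egirth]
  intro a w hw
  rcases exists_mapLe_or_exists_first_adj w with ⟨q, rfl⟩ | ⟨c, d, q, h, r, rfl⟩
  · have := le_egirth.1 h0 _ q ((Walk.isCycle_mapLe _).1 hw)
    simpa using this
  · -- cut the cycle open at the matching edge `cd`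
    have hnd := hw.isTrail.edges_nodup
    rw [Walk.edges_append, Walk.edges_cons, List.nodup_append_comm, List.cons_append,
      List.nodup_cons, ← Walk.edges_append] at hnd
    have := le_length_add_one_of_matching hF h1 h2 h3 h4 h
      (r.append (q.mapLe le_sup_left)) ⟨hnd.2⟩ hnd.1
    simp only [Walk.length_append, Walk.length_cons, Walk.length_map] at this ⊢
    norm_cast
    omega

end Girth

/-! ### Gluing copies of an induced subgraph along a matching of its boundary -/

section Glue

variable {V : Type*} {G : SimpleGraph V} {A : Set V} {k g : ℕ} {ι W : Type*}

/-- `k`-regularity, stated without decidability or local finiteness instances. For `k ≠ 0` it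
agrees with Mathlib's notion, since infinite sets have `ncard` zero. -/
def IsReg (G : SimpleGraph V) (k : ℕ) : Prop := ∀ v, (G.neighborSet v).ncard = k

/-- The vertices of `A` that have a neighbour outside `A`. -/
def innerBoundary (G : SimpleGraph V) (A : Set V) : Set V :=
  {a | a ∈ A ∧ ∃ b, b ∉ A ∧ G.Adj a b}

/-- Every vertex of `A` has at most one neighbour outside `A`. -/
def HasSingleExits (G : SimpleGraph V) (A : Set V) : Prop :=
  ∀ a ∈ A, ∀ b, b ∉ A → ∀ c, c ∉ A → G.Adj a b → G.Adj a c → b = c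

/-- Every walk from `a` to `b` inside `A` has length at least `n`. -/
def IsFar (G : SimpleGraph V) (A : Set V) (a b : V) (n : ℕ) : Prop :=
  ∀ p : G.Walk a b, (∀ v ∈ p.support, v ∈ A) → n ≤ p.length

lemma IsFar.symm {a b : V} {n : ℕ} (h : IsFar G A a b n) : IsFar G A b a n := by
  intro p hp
  simpa using h p.reverse (by simpa using hp)

lemma IsFar.mono {a b : V} {m n : ℕ} (h : IsFar G A a b n) (hmn : m ≤ n) : IsFar G A a b m :=
  fun p hp => hmn.trans (h p hp)

/-- Disjoint copies of the induced subgraph `G[A]`, indexed by `ι`. -/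
def copies (G : SimpleGraph V) (A : Set V) (ι : Type*) : SimpleGraph (A × ι) where
  Adj x y := x.2 = y.2 ∧ G.Adj x.1 y.1
  symm := ⟨fun _ _ h => ⟨h.1.symm, h.2.symm⟩⟩
  loopless := ⟨fun _ h => G.irrefl h.2⟩

/-- The matching formed by the pairs of distinct elements of `S` that `τ` exchanges. -/
def matchingOn (S : Set W) (τ : W → W) : SimpleGraph W where
  Adj x y := x ≠ y ∧ x ∈ S ∧ y ∈ S ∧ τ x = y ∧ τ y = x
  symm := ⟨fun _ _ h => ⟨h.1.symm, h.2.2.1, h.2.1, h.2.2.2.2, h.2.2.2.1⟩⟩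
  loopless := ⟨fun _ h => h.1 rfl⟩

lemma matchingOn_unique (S : Set W) (τ : W → W) (a b c : W) (h : (matchingOn S τ).Adj a b)
    (h' : (matchingOn S τ).Adj a c) : b = c := h.2.2.2.1.symm.trans h'.2.2.2.1

lemma snd_eq_of_walk_copies {x y : A × ι} (p : (copies G A ι).Walk x y) : x.2 = y.2 := by
  induction p with
  | nil => rfl
  | cons h _ ih => exact h.1.trans ih

/-- A walk in the copies of `G[A]` stays in one copy and projects to a walk of `G` inside `A`. -/
lemma exists_walk_of_walk_copies {x y : A × ι} (p : (copies G A ι).Walk x y) :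
    ∃ q : G.Walk (x.1 : V) (y.1 : V), q.length = p.length ∧ (∀ v ∈ q.support, v ∈ A) ∧
      ∀ e ∈ q.edges, ∃ u v : A, e = s((u : V), (v : V)) ∧ s((u, x.2), (v, x.2)) ∈ p.edges := by
  induction p with
  | @nil u => exact ⟨.nil, rfl, by simp, by simp⟩
  | @cons u v w h p ih =>
    obtain ⟨q, hq, hqA, hqe⟩ := ih
    refine ⟨.cons h.2 q, by simp [hq], ?_, ?_⟩
    · intro v hv
      rw [Walk.support_cons, List.mem_cons] at hv
      rcases hv with rfl | hv
      · exact u.1.2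
      · exact hqA v hv
    · intro e he
      rw [Walk.edges_cons, List.mem_cons] at he
      rcases he with rfl | he
      · refine ⟨u.1, v.1, rfl, ?_⟩
        have : (v.1, u.2) = v := Prod.ext rfl h.1
        rw [this]
        simp
      · obtain ⟨a, b, hab, he⟩ := hqe e he
        refine ⟨a, b, hab, ?_⟩
        rw [h.1, Walk.edges_cons]
        exact List.mem_cons_of_mem _ he

lemma le_egirth_copies (hg : (g : ℕ∞) ≤ G.egirth) : (g : ℕ∞) ≤ (copies G A ι).egirth := by
  rw [le_egirth]
  intro x w hw
  cases w with
  | nil => exact absurd rfl hw.ne_nil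
  | @cons _ y _ h p =>
    have hp := ((Walk.cons_isCycle_iff _ _).1 hw).2
    obtain ⟨q, hq, -, hqe⟩ := exists_walk_of_walk_copies p
    have := le_length_add_one_of_notMem_edges hg h.2 q (by
      intro he
      obtain ⟨u, v, huv, he⟩ := hqe _ he
      apply hp
      convert he using 1
      simp only [Sym2.eq_iff] at huv ⊢
      have h1 := h.1
      rcases huv with ⟨h2, h3⟩ | ⟨h2, h3⟩
      · left
        exact ⟨Prod.ext (Subtype.ext h2) h1, Prod.ext (Subtype.ext h3) rfl⟩
      · right
        exact ⟨Prod.ext (Subtype.ext h2) h1, Prod.ext (Subtype.ext h3) rfl⟩)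
    rw [hq] at this
    rw [Walk.length_cons]
    exact_mod_cast this

/-- Each vertex of the copies of `G[A]` lost at most one edge, which the matching replaces. -/
lemma isReg_copies_sup_matchingOn (hreg : IsReg G k)
    (hA : HasSingleExits G A) {τ : A × ι → A × ι}
    (hτ : ∀ x : A × ι, (x.1 : V) ∈ innerBoundary G A →
      (τ x).1.1 ∈ innerBoundary G A ∧ τ (τ x) = x ∧ τ x ≠ x ∧ ¬ (copies G A ι).Adj x (τ x)) :
    IsReg (copies G A ι ⊔ matchingOn {x | (x.1 : V) ∈ innerBoundary G A} τ) k := by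
  classical
  intro x
  let f : V → A × ι := fun w => if h : w ∈ A then (⟨w, h⟩, x.2) else τ x
  have fin : ∀ w (h : w ∈ A), f w = (⟨w, h⟩, x.2) := fun w h => dif_pos h
  have fout : ∀ w, w ∉ A → f w = τ x := fun w h => dif_neg h
  have hbd : ∀ w, G.Adj x.1 w → w ∉ A → (x.1 : V) ∈ innerBoundary G A := fun w h h' =>
    ⟨x.1.2, w, h', h⟩
  have hinj : Set.InjOn f (G.neighborSet x.1) := by
    intro w hw w' hw' he
    rw [mem_neighborSet] at hw hw'
    by_cases h : w ∈ A <;> by_cases h' : w' ∈ A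
    · rw [fin w h, fin w' h'] at he
      simpa using he
    · rw [fin w h, fout w' h'] at he
      exact absurd ⟨by rw [← he], by rw [← he]; exact hw⟩ (hτ x (hbd _ hw' h')).2.2.2
    · rw [fin w' h', fout w h] at he
      exact absurd ⟨by rw [he], by rw [he]; exact hw'⟩ (hτ x (hbd _ hw h)).2.2.2
    · exact hA _ x.1.2 _ h _ h' hw hw'
  rw [← hreg x.1, ← hinj.ncard_image]
  congr 1
  ext y
  simp only [mem_neighborSet, sup_adj, Set.mem_image]
  constructor
  · rintro (h | h)
    · refine ⟨y.1, h.2, ?_⟩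
      rw [fin _ y.1.2]
      exact Prod.ext rfl h.1
    · obtain ⟨_, w, hw, hxw⟩ := h.2.1
      exact ⟨w, hxw, by rw [fout w hw]; exact h.2.2.2.1⟩
  · rintro ⟨w, hw, rfl⟩
    by_cases h : w ∈ A
    · left
      rw [fin w h]
      exact ⟨rfl, hw⟩
    · right
      rw [fout w h]
      have hx := hbd w hw h
      obtain ⟨h1, h2, h3, _⟩ := hτ x hx
      exact ⟨h3.symm, hx, h1, rfl, h2⟩

/-- Two copies of `G[A]`, joined by the edges from `(y, false)` to `(φ y, true)` for a permutation
`φ` of the boundary. Cycles that cross twice are bounded by `h2`, those that cross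
four times or more by `h4`. -/
theorem exists_isReg_of_perm_innerBoundary (hg : (g : ℕ∞) ≤ G.egirth) (hreg : IsReg G k)
    (hA : HasSingleExits G A) (φ : Equiv.Perm (innerBoundary G A))
    (h2 : ∀ y z : innerBoundary G A, y ≠ z → ∃ m n, IsFar G A y z m ∧ IsFar G A (φ y) (φ z) n ∧
      g ≤ m + n + 2)
    (h4 : ∀ y z : innerBoundary G A, y ≠ z → ∃ n, IsFar G A y z n ∧ g ≤ 4 * n + 4) :
    ∃ H : SimpleGraph (A × Bool), IsReg H k ∧ (g : ℕ∞) ≤ H.egirth := by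
  classical
  have hsub : ∀ y : innerBoundary G A, (y : V) ∈ A := fun y => y.2.1
  let τ : A × Bool → A × Bool := fun x =>
    if h : (x.1 : V) ∈ innerBoundary G A then
      match x.2 with
      | false => (⟨φ ⟨x.1, h⟩, hsub _⟩, true)
      | true => (⟨φ.symm ⟨x.1, h⟩, hsub _⟩, false)
    else x
  have τf : ∀ y : innerBoundary G A, τ (⟨y, hsub y⟩, false) = (⟨φ y, hsub _⟩, true) :=
    fun y => dif_pos y.2
  have τt : ∀ y : innerBoundary G A, τ (⟨y, hsub y⟩, true) = (⟨φ.symm y, hsub _⟩, false) :=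
    fun y => dif_pos y.2
  have hτ : ∀ x : A × Bool, (x.1 : V) ∈ innerBoundary G A → (τ x).1.1 ∈ innerBoundary G A ∧
      τ (τ x) = x ∧ τ x ≠ x ∧ ¬ (copies G A Bool).Adj x (τ x) := by
    rintro ⟨⟨a, ha⟩, b⟩ hx
    cases b
    · have := τf ⟨a, hx⟩
      simp only at this
      rw [this, τt (φ ⟨a, hx⟩)]
      exact ⟨(φ ⟨a, hx⟩).2, by simp, by simp, fun h => Bool.false_ne_true h.1⟩
    · have := τt ⟨a, hx⟩
      simp only at this
      rw [this, τf (φ.symm ⟨a, hx⟩)]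
      exact ⟨(φ.symm ⟨a, hx⟩).2, by simp, by simp, fun h => Bool.false_ne_true h.1.symm⟩
  -- matching edges cross between the two copies
  have hcross : ∀ a b, (matchingOn {x : A × Bool | (x.1 : V) ∈ innerBoundary G A} τ).Adj a b →
      ∃ y : innerBoundary G A,
        (a = (⟨y, hsub y⟩, false) ∧ b = (⟨φ y, hsub _⟩, true)) ∨
        (b = (⟨y, hsub y⟩, false) ∧ a = (⟨φ y, hsub _⟩, true)) := by
    rintro ⟨⟨a, ha⟩, s⟩ b ⟨-, hx, -, rfl, -⟩
    cases s
    · exact ⟨⟨a, hx⟩, Or.inl ⟨rfl, τf ⟨a, hx⟩⟩⟩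
    · refine ⟨φ.symm ⟨a, hx⟩, Or.inr ⟨τt ⟨a, hx⟩, by simp⟩⟩
  have hsnd : ∀ a b, (matchingOn {x : A × Bool | (x.1 : V) ∈ innerBoundary G A} τ).Adj a b →
      a.2 = !b.2 := by
    intro a b h
    obtain ⟨y, ⟨rfl, rfl⟩ | ⟨rfl, rfl⟩⟩ := hcross a b h <;> rfl
  refine ⟨_, isReg_copies_sup_matchingOn hreg hA hτ,
    le_egirth_sup_of_matching (le_egirth_copies hg) (matchingOn_unique _ _) ?_ ?_ ?_ ?_⟩
  · intro a b hab p
    have e1 := hsnd _ _ hab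
    have e2 := snd_eq_of_walk_copies p
    rw [e2] at e1
    simp at e1
  · intro a b c d hab hcd hcb hca p q
    have e1 := snd_eq_of_walk_copies p
    obtain ⟨p', hp, hpA, -⟩ := exists_walk_of_walk_copies p
    obtain ⟨q', hq, hqA, -⟩ := exists_walk_of_walk_copies q
    rw [← hp, ← hq]
    obtain ⟨y, ⟨rfl, rfl⟩ | ⟨rfl, rfl⟩⟩ := hcross a b hab <;>
      obtain ⟨z, ⟨rfl, rfl⟩ | ⟨rfl, rfl⟩⟩ := hcross c d hcd
    · simp at e1
    · have hyz : y ≠ z := by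
        rintro rfl
        exact hcb rfl
      obtain ⟨m, n, hm, hn, hmn⟩ := h2 y z hyz
      have i1 := hm.symm q' hqA
      have i2 := hn p' hpA
      omega
    · have hyz : y ≠ z := by
        rintro rfl
        exact hcb rfl
      obtain ⟨m, n, hm, hn, hmn⟩ := h2 y z hyz
      have i1 := hm p' hpA
      have i2 := hn.symm q' hqA
      omega
    · simp at e1
  · intro a b c d e f hab hcd hef _ _ p q r
    have e1 := hsnd _ _ hab
    have e2 := hsnd _ _ hcd
    have e3 := hsnd _ _ hef
    have e4 := snd_eq_of_walk_copies p
    have e5 := snd_eq_of_walk_copies q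
    have e6 := snd_eq_of_walk_copies r
    rw [e4, e2, e5, e3, e6] at e1
    simp at e1
  · intro a b c d hab hcd hbc p
    obtain ⟨p', hp, hpA, -⟩ := exists_walk_of_walk_copies p
    have e := snd_eq_of_walk_copies p
    rw [← hp]
    have hne : (b.1 : V) ≠ c.1 := fun h => hbc (Prod.ext (Subtype.ext h) e)
    obtain ⟨n, hn, hgn⟩ := h4 ⟨b.1, hab.2.2.1⟩ ⟨c.1, hcd.2.1⟩ 
      (fun h => hne (congrArg (fun y : innerBoundary G A => (y : V)) h))
    have := hn p' hpA
    omega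

lemma exists_involution_of_even_ncard [Finite V] (s : Set V) (hs : Even s.ncard) :
    ∃ τ : V → V, ∀ y ∈ s, τ y ∈ s ∧ τ y ≠ y ∧ τ (τ y) = y := by
  classical
  obtain ⟨r, hr⟩ := hs
  let e : s ≃ Fin r ⊕ Fin r :=
    (Finite.equivFinOfCardEq (by rw [Nat.card_coe_set_eq, hr])).trans finSumFinEquiv.symm
  let τ : V → V := fun y => if h : y ∈ s then e.symm (e ⟨y, h⟩).swap else y
  have hτ : ∀ y : s, τ y = e.symm (e y).swap := fun y => dif_pos y.2
  refine ⟨τ, fun y hy => ?_⟩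
  have h1 := hτ ⟨y, hy⟩
  simp only at h1
  rw [h1, hτ]
  refine ⟨Subtype.coe_prop _, fun h => ?_, by simp⟩
  have h2 : e.symm (e ⟨y, hy⟩).swap = ⟨y, hy⟩ := Subtype.ext h
  rw [Equiv.symm_apply_eq] at h2
  cases h3 : e ⟨y, hy⟩ <;> rw [h3] at h2 <;> simp at h2

/-- Deleting a set `U` that is a vertex or the two ends of an edge, and matching up the neighbours
of each of its vertices, decreases the girth by at most one. -/
lemma exists_isReg_compl [Finite V] (hg : ((g + 1 : ℕ) : ℕ∞) ≤ G.egirth) (hg3 : 3 ≤ g)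
    (hreg : IsReg G k) {U : Set V} (hU : ∀ u ∈ U, ∀ v ∈ U, u ≠ v → G.Adj u v)
    (hev : ∀ u ∈ U, Even (G.neighborSet u ∩ Uᶜ).ncard) :
    ∃ H : SimpleGraph ((Uᶜ : Set V) × Unit), IsReg H k ∧ (g : ℕ∞) ≤ H.egirth := by
  classical
  have huniq : ∀ a u v, u ∈ U → v ∈ U → G.Adj a u → G.Adj a v → u = v := by
    intro a u v hu hv hau hav
    by_contra hne
    exact not_adj_of_adj_of_adj hg (by omega) hau hav (hU u hu v hv hne)
  have hA : HasSingleExits G Uᶜ := fun a _ b hb c hc hab hac =>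
    huniq a b c (not_not.1 hb) (not_not.1 hc) hab hac
  have hev' : ∀ u, ∃ τ : V → V, u ∈ U → ∀ y, G.Adj u y → y ∉ U →
      (G.Adj u (τ y) ∧ τ y ∉ U) ∧ τ y ≠ y ∧ τ (τ y) = y := by
    intro u
    by_cases hu : u ∈ U
    · obtain ⟨τ, hτ⟩ := exists_involution_of_even_ncard _ (hev u hu)
      exact ⟨τ, fun _ y h1 h2 => hτ y ⟨h1, h2⟩⟩
    · exact ⟨id, fun h => absurd h hu⟩
  choose σ hσ using hev'
  have hκ : ∀ y, ∃ u, y ∈ innerBoundary G Uᶜ → u ∈ U ∧ G.Adj y u := by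
    intro y
    by_cases hy : y ∈ innerBoundary G Uᶜ
    · obtain ⟨_, u, hu, hyu⟩ := hy
      exact ⟨u, fun _ => ⟨not_not.1 hu, hyu⟩⟩
    · exact ⟨y, fun h => absurd h hy⟩
  choose κ hκ using hκ
  have hσκ : ∀ y ∈ innerBoundary G Uᶜ, (G.Adj (κ y) (σ (κ y) y) ∧ σ (κ y) y ∉ U) ∧
      σ (κ y) y ≠ y ∧ σ (κ y) (σ (κ y) y) = y := fun y hy =>
    hσ (κ y) (hκ y hy).1 y (hκ y hy).2.symm hy.1
  let τ : (Uᶜ : Set V) × Unit → (Uᶜ : Set V) × Unit := fun x =>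
    if h : (x.1 : V) ∈ innerBoundary G Uᶜ then (⟨σ (κ x.1) x.1, (hσκ x.1 h).1.2⟩, ()) else x
  have τe : ∀ x : (Uᶜ : Set V) × Unit, (x.1 : V) ∈ innerBoundary G Uᶜ →
      ((τ x).1 : V) = σ (κ x.1) x.1 := by
    intro x h
    simp only [τ, dif_pos h]
  have hτb : ∀ x : (Uᶜ : Set V) × Unit, (x.1 : V) ∈ innerBoundary G Uᶜ →
      ((τ x).1 : V) ∈ innerBoundary G Uᶜ := fun x h =>
    ⟨(τ x).1.2, κ x.1, not_not.2 (hκ _ h).1, by rw [τe x h]; exact (hσκ _ h).1.1.symm⟩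
  have hτ : ∀ x : (Uᶜ : Set V) × Unit, (x.1 : V) ∈ innerBoundary G Uᶜ →
      ((τ x).1 : V) ∈ innerBoundary G Uᶜ ∧ τ (τ x) = x ∧ τ x ≠ x ∧
        ¬ (copies G Uᶜ Unit).Adj x (τ x) := by
    intro x h
    refine ⟨hτb x h, Prod.ext (Subtype.ext ?_) rfl, fun e => ?_, fun e => ?_⟩
    · have : κ (τ x).1 = κ x.1 := huniq (τ x).1 _ _ (hκ _ (hτb x h)).1 (hκ _ h).1
        (hκ _ (hτb x h)).2 (by rw [τe x h]; exact (hσκ _ h).1.1.symm)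
      rw [τe _ (hτb x h), this, τe x h]
      exact (hσκ _ h).2.2
    · exact (hσκ _ h).2.1 (by rw [← τe x h, e])
    · have h1 := e.2
      rw [τe x h] at h1
      exact not_adj_of_adj_of_adj hg (by omega) (hκ _ h).2.symm (hσκ _ h).1.1 h1
  have hfar : ∀ b c : (Uᶜ : Set V) × Unit, (b.1 : V) ∈ innerBoundary G Uᶜ →
      (c.1 : V) ∈ innerBoundary G Uᶜ → b ≠ c → ∀ p : (copies G Uᶜ Unit).Walk b c,
        g ≤ p.length + 2 := by
    intro b c hb hc hbc p
    obtain ⟨q, hq, hqA, -⟩ := exists_walk_of_walk_copies p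
    rw [← hq]
    have hne : (b.1 : V) ≠ c.1 := fun e => hbc (Prod.ext (Subtype.ext e) rfl)
    obtain ⟨hu, hbu⟩ := hκ _ hb
    obtain ⟨hv, hcv⟩ := hκ _ hc
    by_cases huv : κ b.1 = κ c.1
    · have := le_length_add_two_of_adj hg hbu.symm (huv ▸ hcv.symm) hne q
        (fun h => hqA _ h hu)
      omega
    · have := le_length_add_one_of_notMem_edges hg (hU _ hv _ hu (Ne.symm huv))
        ((Walk.cons hbu.symm q).append (.cons hcv .nil)) (by
          rw [Walk.edges_append, Walk.edges_cons]
          simp only [List.mem_append, List.mem_cons, Walk.edges_cons, Walk.edges_nil,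
            List.not_mem_nil, or_false]
          rintro ((h | h) | h)
          · rcases Sym2.eq_iff.1 h with e | e
            · exact huv e.1.symm
            · exact b.1.2 (e.1 ▸ hv)
          · exact hqA _ (q.fst_mem_support_of_mem_edges h) hv
          · rcases Sym2.eq_iff.1 h with e | e
            · exact huv e.2
            · exact c.1.2 (e.2 ▸ hu))
      simp at this
      omega
  refine ⟨_, isReg_copies_sup_matchingOn hreg hA hτ,
    le_egirth_sup_of_matching (le_egirth_copies ((Nat.cast_le.2 (Nat.le_succ g)).trans hg))
      (matchingOn_unique _ _) ?_ ?_ ?_ ?_⟩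
  · intro a b hab p
    obtain ⟨q, hq, hqA, -⟩ := exists_walk_of_walk_copies p
    rw [← hq]
    obtain ⟨hab, ha, hb, rfl, -⟩ := hab
    have := le_length_add_two_of_adj hg (v := κ a.1) (by rw [τe a ha]; exact (hσκ _ ha).1.1)
      (hκ _ ha).2.symm (by rw [τe a ha]; exact (hσκ _ ha).2.1) q (fun h => hqA _ h (hκ _ ha).1)
    omega
  · intro a b c d hab hcd hcb hca p q
    have i1 := hfar b c hab.2.2.1 hcd.2.1 hcb.symm p
    have i2 := hfar d a hcd.2.2.1 hab.2.1 (by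
      rintro rfl
      exact hcb (matchingOn_unique _ _ _ _ _ hcd.symm hab)) q
    omega
  · intro a b c d e f hab hcd hef hcb hed p q r
    have i1 := hfar b c hab.2.2.1 hcd.2.1 hcb.symm p
    have i2 := hfar d e hcd.2.2.1 hef.2.1 hed.symm q
    omega
  · intro a b c d hab hcd hbc p
    have i1 := hfar b c hab.2.2.1 hcd.2.1 hbc p
    omega

/-- A regular graph whose girth exceeds `g` yields a smaller one of girth at least `g`. -/
lemma exists_smaller_isReg [Finite V] [Nonempty V] (hg : ((g + 1 : ℕ) : ℕ∞) ≤ G.egirth)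
    (hg3 : 3 ≤ g) (hk : 3 ≤ k) (hreg : IsReg G k) :
    ∃ A : Set V, A.Nonempty ∧ A.ncard < Nat.card V ∧
      ∃ H : SimpleGraph (A × Unit), IsReg H k ∧ (g : ℕ∞) ≤ H.egirth := by
  obtain ⟨u⟩ := ‹Nonempty V›
  have hlt : ∀ U : Set V, U.Nonempty → (Uᶜ : Set V).ncard < Nat.card V := by
    intro U hU
    have h1 := Set.ncard_add_ncard_compl U
    have h2 := (Set.ncard_pos (s := U)).2 hU
    omega
  have hex : ∀ v, ∃ w, G.Adj u w ∧ w ≠ v := by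
    intro v
    by_contra hcon
    push Not at hcon
    have : G.neighborSet u ⊆ {v} := fun w hw => hcon w hw
    have := Set.ncard_le_ncard this
    rw [hreg u, Set.ncard_singleton] at this
    omega
  rcases Nat.even_or_odd k with he | ho
  · obtain ⟨w, hw, hwu⟩ := hex u
    refine ⟨{u}ᶜ, ⟨w, hwu⟩, hlt _ ⟨u, rfl⟩, exists_isReg_compl hg hg3 hreg ?_ ?_⟩
    · rintro _ rfl _ rfl h
      exact absurd rfl h
    · intro v hv
      obtain rfl : v = u := hv
      have : G.neighborSet v ∩ {v}ᶜ = G.neighborSet v :=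
        Set.inter_eq_left.2 fun w hw => by simpa using (G.ne_of_adj hw).symm
      rw [this, hreg v]
      exact he
  · obtain ⟨v, huv, -⟩ := hex u
    obtain ⟨w, hw, hwv⟩ := hex v
    have key : ∀ a b, G.Adj a b → Even (G.neighborSet a ∩ {a, b}ᶜ).ncard := by
      intro a b hab
      have : G.neighborSet a ∩ {a, b}ᶜ = G.neighborSet a \ {b} := by
        ext w
        simp only [Set.mem_inter_iff, mem_neighborSet, Set.mem_compl_iff, Set.mem_insert_iff,
          Set.mem_singleton_iff, not_or, Set.mem_sdiff]
        exact ⟨fun h => ⟨h.1, h.2.2⟩, fun h => ⟨h.1, h.1.ne', h.2⟩⟩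
      rw [this, Set.ncard_sdiff_singleton_of_mem ((G.mem_neighborSet a b).2 hab), hreg a]
      exact ho.tsub_odd odd_one
    refine ⟨{u, v}ᶜ, ⟨w, ?_⟩, hlt _ ⟨u, by simp⟩, exists_isReg_compl hg hg3 hreg ?_ ?_⟩
    · simp [hw.ne', hwv]
    · rintro a (rfl | rfl) b (rfl | rfl) h
      · exact absurd rfl h
      · exact huv
      · exact huv.symm
      · exact absurd rfl h
    · rintro a (rfl | rfl)
      · exact key _ _ huv
      · rw [Set.pair_comm]
        exact key _ _ huv.symm

lemma isReg_of_isRegularOfDegree [G.LocallyFinite] (h : G.IsRegularOfDegree k) :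
    IsReg G k := by
  intro v
  rw [Set.ncard_eq_toFinset_card', ← h v]
  rfl

lemma isRegularOfDegree_of_isReg [G.LocallyFinite] (h : IsReg G k) :
    G.IsRegularOfDegree k := by
  intro v
  rw [← h v, Set.ncard_eq_toFinset_card']
  rfl

/-- A cage has minimum order even among the regular graphs whose girth is only bounded below. -/
theorem card_le_of_isCage [Fintype V] [G.LocallyFinite] (hG : G.IsCage k g) (hg3 : 3 ≤ g)
    (hk : 3 ≤ k) (n : ℕ) : ∀ {W : Type*} [Finite W] [Nonempty W] {H : SimpleGraph W},
      Nat.card W = n → IsReg H k → (g : ℕ∞) ≤ H.egirth → Fintype.card V ≤ n := by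
  classical
  induction n using Nat.strong_induction_on with
  | _ n ih =>
    intro W _ _ H hW hreg hg
    rcases hg.eq_or_lt with he | hlt
    · let e : W ≃ Fin n := Finite.equivFinOfCardEq hW
      let H' : SimpleGraph (Fin n) := H.map e.toEmbedding
      let i : H ≃g H' := SimpleGraph.Iso.map e H
      refine hG.2 n H' ⟨isRegularOfDegree_of_isReg fun v => ?_, ?_⟩
      · obtain ⟨w, rfl⟩ := e.surjective v
        rw [← hreg w, ← Set.ncard_image_of_injective _ e.injective]
        congr 1
        ext v
        obtain ⟨w', rfl⟩ := e.surjective v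
        simp only [mem_neighborSet, Set.mem_image, EmbeddingLike.apply_eq_iff_eq,
          exists_eq_right]
        exact i.map_adj_iff
      · rw [← i.egirth_eq, he]
    · have hlt' : ((g + 1 : ℕ) : ℕ∞) ≤ H.egirth := by
        push_cast
        exact Order.add_one_le_of_lt hlt
      obtain ⟨A, hA, hAc, H', hreg', hg'⟩ := exists_smaller_isReg hlt' hg3 hk hreg
      have : Nonempty (A × Unit) := ⟨⟨⟨_, hA.some_mem⟩, ()⟩⟩
      have hc : Nat.card (A × Unit) = A.ncard := by simp
      exact (ih A.ncard (hW ▸ hAc) hc hreg' hg').trans (hW ▸ hAc.le)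

end Glue

/-! ### Sets with a sparse boundary in a cage -/

section Boundary

variable {V : Type*} {G : SimpleGraph V} {A : Set V} {k g : ℕ}

/-- A set whose boundary can be packed with itself has at least half of the vertices of the cage.
Boundary pairs related by `R` may be as close as `a`, the others are at distance at least `b`. -/
theorem card_le_or_star [Fintype V] [G.LocallyFinite] (hG : G.IsCage k g) (hk : 3 ≤ k)
    (hg5 : 5 ≤ g) (hodd : Odd g) (hne : A.Nonempty) (hA : HasSingleExits G A)
    {c : innerBoundary G A → ZMod g} {R : innerBoundary G A → innerBoundary G A → Prop}
    (hR : IsLayered c R) {a b : ℕ} (ha : ∀ y z : innerBoundary G A, y ≠ z → IsFar G A y z a)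
    (hb : ∀ y z : innerBoundary G A, y ≠ z → ¬ R y z → ¬ R z y → IsFar G A y z b)
    (hab : g ≤ a + b + 2) (hbb : g ≤ 2 * b + 2) (haa : g ≤ 4 * a + 4) :
    Fintype.card V ≤ 2 * A.ncard ∨
      ((innerBoundary G A).ncard ≤ 3 ∧ ∃ e, IsStarCentre R e) := by
  classical
  rcases hR.exists_packing_or_star hg5 hodd with ⟨φ, hφ⟩ | ⟨h3, he⟩
  · left
    obtain ⟨H, hH, hHg⟩ := exists_isReg_of_perm_innerBoundary hG.1.2.ge
      (isReg_of_isRegularOfDegree hG.1.1) hA φ (by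
        intro y z hyz
        have hne := φ.injective.ne hyz
        by_cases h1 : R y z ∨ R z y
        · have h2 : ¬ R (φ y) (φ z) ∧ ¬ R (φ z) (φ y) := by
            rcases h1 with h1 | h1
            · exact hφ _ _ h1
            · exact (hφ _ _ h1).symm
          exact ⟨a, b, ha y z hyz, hb _ _ hne h2.1 h2.2, hab⟩
        · push Not at h1
          by_cases h2 : R (φ y) (φ z) ∨ R (φ z) (φ y)
          · exact ⟨b, a, hb _ _ hyz h1.1 h1.2, ha _ _ hne, by omega⟩
          · push Not at h2
            exact ⟨b, b, hb _ _ hyz h1.1 h1.2, hb _ _ hne h2.1 h2.2, by omega⟩)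
      (fun y z hyz => ⟨a, ha y z hyz, haa⟩)
    have : Nonempty (A × Bool) := ⟨⟨⟨_, hne.some_mem⟩, true⟩⟩
    have hc : Nat.card (A × Bool) = 2 * A.ncard := by
      rw [Nat.card_prod, Nat.card_coe_set_eq, mul_comm]
      simp
    exact card_le_of_isCage hG (by omega) hk _ hc hH hHg
  · right
    refine ⟨?_, he⟩
    rwa [← Nat.card_coe_set_eq, Nat.card_eq_fintype_card]

lemma exists_adj_mem_ne [Finite V] (hreg : IsReg G k) (hk : 3 ≤ k) (hA : HasSingleExits G A)
    {v : V} (hv : v ∈ A) (a : V) : ∃ w ∈ A, G.Adj v w ∧ w ≠ a := by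
  have h3 : 2 < (G.neighborSet v).ncard := by rw [hreg v]; omega
  obtain ⟨w₁, h1, hw1⟩ : ∃ w ∈ G.neighborSet v, w ≠ a :=
    Set.exists_ne_of_one_lt_ncard (by omega) a
  have : 1 < (G.neighborSet v \ {w₁}).ncard := by
    rw [Set.ncard_sdiff_singleton_of_mem h1]
    omega
  obtain ⟨w₂, h2, hw2⟩ := Set.exists_ne_of_one_lt_ncard this a
  by_cases hA1 : w₁ ∈ A
  · exact ⟨w₁, hA1, h1, hw1⟩
  · refine ⟨w₂, by_contra fun hA2 => h2.2 ?_, h2.1, hw2⟩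
    exact hA v hv _ hA2 _ hA1 h2.1 h1

/-- In a cage of girth five, a set whose boundary is a star with one or two leaves has at least
half of the vertices: deleting the boundary leaves a set whose boundary can be packed with itself
or is a star again. -/
lemma card_le_of_boundary_star_of_girth_five [Fintype V] [G.LocallyFinite] (hG : G.IsCage k 5)
    (hk : 3 ≤ k) (n : ℕ) : ∀ A : Set V, A.ncard = n → A.Nonempty → HasSingleExits G A →
      (innerBoundary G A).ncard ≤ 3 →
      (∃ e ∈ innerBoundary G A, ∃ f ∈ innerBoundary G A, f ≠ e ∧
        ∀ y ∈ innerBoundary G A, y ≠ e → G.Adj e y) → Fintype.card V ≤ 2 * A.ncard := by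
  classical
  have hgi : ((5 : ℕ) : ℕ∞) ≤ G.egirth := hG.1.2.ge
  have hreg := isReg_of_isRegularOfDegree hG.1.1
  induction n using Nat.strong_induction_on with
  | _ n ih =>
    intro A hn hne hA h3 ⟨e, he, f, hf, hfe, hstar⟩
    set Y := innerBoundary G A with hY
    have hYA : Y ⊆ A := fun y hy => hy.1
    have hYuniq : ∀ v b c, v ∉ Y → b ∈ Y → c ∈ Y → G.Adj v b → G.Adj v c → b = c := by
      intro v b c hv hb hc hvb hvc
      by_contra hbc
      by_cases hbe : b = e
      · subst hbe
        exact not_adj_of_adj_of_adj hgi (by norm_num) hvb hvc (hstar c hc (Ne.symm hbc))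
      by_cases hce : c = e
      · subst hce
        exact not_adj_of_adj_of_adj hgi (by norm_num) hvc hvb (hstar b hb hbc)
      have := eq_of_common_adj hgi le_rfl hbc hvb.symm hvc (hstar c hc hce).symm (hstar b hb hbe)
      exact hv (this ▸ he)
    have hthree : ∀ y z, y ∈ Y → z ∈ Y → y ≠ e → y ≠ f → z ≠ e → z ≠ f → y = z := by
      intro y z hy hz h1 h2 h4 h5
      by_contra hyz
      have hsub : (↑({e, f, y, z} : Finset V) : Set V) ⊆ Y := by
        intro x hx
        simp only [Finset.coe_insert, Finset.coe_singleton, Set.mem_insert_iff,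
          Set.mem_singleton_iff] at hx
        rcases hx with rfl | rfl | rfl | rfl <;> assumption
      have := Set.ncard_le_ncard hsub
      rw [Set.ncard_coe_finset, Finset.card_eq_of_equiv_fin (n := 4)] at this
      · omega
      · apply Finset.equivFinOfCardEq
        rw [Finset.card_insert_of_notMem, Finset.card_insert_of_notMem,
          Finset.card_insert_of_notMem, Finset.card_singleton]
        · simpa using hyz
        · simp [h2.symm, h5.symm]
        · simp [hfe.symm, h1.symm, h4.symm]
    set A' := A \ Y with hA'
    have hYout : ∀ v ∈ A', ∀ b, b ∉ A' → G.Adj v b → b ∈ Y := by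
      intro v hv b hb hvb
      by_contra hbY
      by_cases hbA : b ∈ A
      · exact hb ⟨hbA, hbY⟩
      · exact hv.2 ⟨hv.1, b, hbA, hvb⟩
    have hS : HasSingleExits G A' := fun v hv b hb c hc hvb hvc =>
      hYuniq v b c hv.2 (hYout v hv b hb hvb) (hYout v hv c hc hvc) hvb hvc
    have hbd : ∀ z ∈ innerBoundary G A', z ∉ Y ∧ ∃ y ∈ Y, G.Adj z y := by
      rintro z ⟨hz, b, hb, hzb⟩
      exact ⟨hz.2, b, hYout z hz b hb hzb, hzb⟩
    have hne' : A'.Nonempty := by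
      obtain ⟨w, hwA, hfw, hwe⟩ := exists_adj_mem_ne hreg hk hA hf.1 e
      exact ⟨w, hwA, fun hwY => not_adj_of_adj_of_adj hgi (by norm_num) (hstar f hf hfe)
        (hstar w hwY hwe) hfw⟩
    have hcard : A'.ncard < A.ncard :=
      Set.ncard_lt_ncard ⟨Set.sdiff_subset, fun h => (h (hYA he)).2 he⟩
    -- adjacent boundary vertices of the smaller set hang from different leaves of the star
    have hadj : ∀ z ∈ innerBoundary G A', ∀ z' ∈ innerBoundary G A', G.Adj z z' →
        ∃ y ∈ Y, y ≠ e ∧ y ≠ f ∧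
          ((G.Adj z f ∧ ¬ G.Adj z' f ∧ G.Adj z' y) ∨ (G.Adj z' f ∧ ¬ G.Adj z f ∧ G.Adj z y)) := by
      intro z hz z' hz' hzz
      obtain ⟨hzY, y, hy, hzy⟩ := hbd z hz
      obtain ⟨hzY', y', hy', hzy'⟩ := hbd z' hz'
      have hyy : y ≠ y' := by
        rintro rfl
        exact not_adj_of_adj_of_adj hgi (by norm_num) hzy.symm hzy'.symm hzz
      have hnadj : ¬ G.Adj y y' := by
        intro h
        have := eq_of_common_adj hgi le_rfl (a := z) (c := y') (fun e => hzY (e ▸ hy')) hzy h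
          hzy'.symm hzz.symm
        exact hzY' (this ▸ hy)
      have hye : y ≠ e := by
        rintro rfl
        exact hnadj (hstar y' hy' hyy.symm)
      have hye' : y' ≠ e := by
        rintro rfl
        exact hnadj (hstar y hy hyy).symm
      by_cases hyf : y = f
      · subst hyf
        exact ⟨y', hy', hye', hyy.symm, Or.inl ⟨hzy,
          fun h => hyy (hYuniq z' _ _ hzY' hy hy' h hzy'), hzy'⟩⟩
      by_cases hyf' : y' = f
      · subst hyf'
        exact ⟨y, hy, hye, hyy, Or.inr ⟨hzy',
          fun h => hyy (hYuniq z _ _ hzY hy hy' hzy h), hzy⟩⟩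
      exact absurd (hthree y y' hy hy' hye hyf hye' hyf') hyy
    let R : innerBoundary G A' → innerBoundary G A' → Prop := fun z z' =>
      G.Adj (z : V) z' ∧ G.Adj (z : V) f ∧ ¬ G.Adj (z' : V) f
    let c : innerBoundary G A' → ZMod 5 := fun z => if G.Adj (z : V) f then 0 else 1
    have hR : IsLayered c R := by
      refine ⟨fun x y h => ?_, fun x y z h h' => Subtype.ext ?_, fun x y z h h' => Subtype.ext ?_⟩
      · simp [c, h.2.1, h.2.2]
      · obtain ⟨y₁, hy1, he1, hf1, ⟨-, -, h1⟩ | ⟨h1, -⟩⟩ := hadj x x.2 y y.2 h.1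
        · obtain ⟨y₂, hy2, he2, hf2, ⟨-, -, h2⟩ | ⟨h2, -⟩⟩ := hadj x x.2 z z.2 h'.1
          · have := hthree _ _ hy1 hy2 he1 hf1 he2 hf2
            subst this
            exact eq_of_common_adj hgi le_rfl (a := x.1) (c := y₁)
              (fun e => (hbd x x.2).1 (e ▸ hy1)) h.1 h1 h2.symm h'.1.symm
          · exact absurd h2 h'.2.2
        · exact absurd h1 h.2.2
      · exact eq_of_common_adj hgi le_rfl (a := z.1) (c := f)
          (fun e => (hbd z z.2).1 (e ▸ hf)) h.1.symm h.2.1 h'.2.1.symm h'.1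
    have hfar1 : ∀ y z : innerBoundary G A', y ≠ z → IsFar G A' y z 1 := by
      intro y z hyz p _
      by_contra hp
      exact hyz (Subtype.ext (Walk.eq_of_length_eq_zero (by omega : p.length = 0)))
    have hfar2 : ∀ y z : innerBoundary G A', y ≠ z → ¬ R y z → ¬ R z y → IsFar G A' y z 2 := by
      intro y z hyz h1 h2 p hp
      have h0 := hfar1 y z hyz p hp
      by_contra hlt
      have h := Walk.adj_of_length_eq_one (by omega : p.length = 1)
      obtain ⟨_, -, -, -, ⟨h3, h4, -⟩ | ⟨h3, h4, -⟩⟩ := hadj y y.2 z z.2 h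
      · exact h1 ⟨h, h3, h4⟩
      · exact h2 ⟨h.symm, h3, h4⟩
    have hle : Fintype.card V ≤ 2 * A'.ncard := by
      rcases card_le_or_star hG hk le_rfl (by decide) hne' hS hR hfar1 hfar2 (by norm_num)
        (by norm_num) (by norm_num) with h | ⟨h3', e', ⟨f', hfe', -⟩, hst⟩
      · exact h
      · refine ih _ (hn ▸ hcard) A' rfl hne' hS h3' ⟨e', e'.2, f', f'.2,
          fun h => hfe' (Subtype.ext h), fun y hy hye => ?_⟩
        rcases hst ⟨y, hy⟩ (fun h => hye (congrArg Subtype.val h)) with h | h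
        · exact h.1
        · exact h.1.symm
    omega

/-- If some boundary vertex `e` is within distance `m - 1` of all others, and these are far from
each other, then deleting `e` yields a set whose boundary can be packed with itself. -/
lemma card_le_of_boundary_star [Fintype V] [G.LocallyFinite] {m : ℕ} (hm : 3 ≤ m)
    (hG : G.IsCage k (2 * m + 1)) (hk : 3 ≤ k) (hA : HasSingleExits G A)
    (hfar : ∀ y ∈ innerBoundary G A, ∀ z ∈ innerBoundary G A, y ≠ z → IsFar G A y z (m - 1))
    {e f : V} (he : e ∈ innerBoundary G A) (hf : f ∈ innerBoundary G A) (hfe : f ≠ e)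
    (hnear : ∀ y ∈ innerBoundary G A, y ≠ e → ¬ IsFar G A e y m)
    (hleaf : ∀ y ∈ innerBoundary G A, ∀ z ∈ innerBoundary G A, y ≠ e → z ≠ e → y ≠ z →
      IsFar G A y z (2 * m - 2)) : Fintype.card V ≤ 2 * A.ncard := by
  classical
  have hgi : ((2 * m + 1 : ℕ) : ℕ∞) ≤ G.egirth := hG.1.2.ge
  have hreg := isReg_of_isRegularOfDegree hG.1.1
  set Y := innerBoundary G A with hY
  set A' := A \ {e} with hA'
  have hsub : A' ⊆ A := Set.sdiff_subset
  have hnadj : ∀ y ∈ Y, ¬ G.Adj e y := by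
    intro y hy h
    have := hfar e he y hy h.ne (.cons h .nil) (by simp [he.1, hy.1])
    simp at this
    omega
  have hS : HasSingleExits G A' := by
    intro v hv b hb c hc hvb hvc
    have hcases : ∀ x, x ∉ A' → x = e ∨ x ∉ A := fun x hx => by
      by_contra hcon
      push Not at hcon
      exact hx ⟨hcon.2, hcon.1⟩
    rcases hcases b hb with rfl | hbA <;> rcases hcases c hc with rfl | hcA
    · rfl
    · exact absurd hvb.symm (hnadj v ⟨hv.1, c, hcA, hvc⟩)
    · exact absurd hvc.symm (hnadj v ⟨hv.1, b, hbA, hvb⟩)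
    · exact hA v hv.1 b hbA c hcA hvb hvc
  have hbd : ∀ z ∈ innerBoundary G A', G.Adj e z ∨ z ∈ Y ∧ z ≠ e := by
    rintro z ⟨hz, b, hb, hzb⟩
    by_cases hbe : b = e
    · exact Or.inl (hbe ▸ hzb.symm)
    · exact Or.inr ⟨⟨hz.1, b, fun h => hb ⟨h, hbe⟩, hzb⟩, hz.2⟩
  have hfar' : ∀ {y z n}, IsFar G A y z n → IsFar G A' y z n := fun h p hp =>
    h p fun v hv => hsub (hp v hv)
  have hnn : ∀ z z', G.Adj e z → G.Adj e z' → z ≠ z' → IsFar G A' z z' (2 * m - 1) := by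
    intro z z' hz hz' hne p hp
    have := le_length_add_two_of_adj hgi hz hz' hne p (fun h => (hp e h).2 rfl)
    omega
  have hstep : ∀ y ∈ Y, y ≠ e → ∃ z, G.Adj e z ∧ ¬ IsFar G A' z y (m - 1) := by
    intro y hy hye
    have := hnear y hy hye
    unfold IsFar at this
    push Not at this
    obtain ⟨p, hpA, hpm⟩ := this
    have hb := p.bypass_isPath
    have hl := p.length_bypass_le_length
    have hs := p.support_bypass_subset_support
    cases hq : p.bypass with
    | nil => exact absurd rfl hye
    | @cons _ z _ h q =>
      rw [hq] at hb hl hs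
      rw [Walk.cons_isPath_iff] at hb
      refine ⟨z, h, fun hF => ?_⟩
      have := hF q (fun v hv => ⟨hpA v (hs (by simp [hv])), fun hve => hb.2 (hve ▸ hv)⟩)
      rw [Walk.length_cons] at hl
      omega
  have hnotfar : ∀ {B : Set V} {y z n}, ¬ IsFar G B y z n →
      ∃ p : G.Walk y z, (∀ v ∈ p.support, v ∈ B) ∧ p.length < n := by
    intro B y z n h
    unfold IsFar at h
    push Not at h
    exact h
  have happ : ∀ {B : Set V} {x y z : V} {p : G.Walk x y} {q : G.Walk y z},
      (∀ v ∈ p.support, v ∈ B) → (∀ v ∈ q.support, v ∈ B) →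
      ∀ v ∈ (p.append q).support, v ∈ B := by
    intro B x y z p q hp hq v hv
    rw [Walk.mem_support_append_iff] at hv
    exact hv.elim (hp v) (hq v)
  have hrev : ∀ {B : Set V} {x y : V} {p : G.Walk x y}, (∀ v ∈ p.support, v ∈ B) →
      ∀ v ∈ p.reverse.support, v ∈ B := by
    intro B x y p hp v hv
    exact hp v (by simpa using hv)
  let R : innerBoundary G A' → innerBoundary G A' → Prop := fun z y =>
    G.Adj e z ∧ (y : V) ∈ Y ∧ ¬ IsFar G A' z y (m - 1)
  let c : innerBoundary G A' → ZMod (2 * m + 1) := fun z => if G.Adj e z then 0 else 1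
  have hmem : ∀ y : innerBoundary G A', (y : V) ≠ e := fun y => y.2.1.2
  have hR : IsLayered c R := by
    refine ⟨fun x y h => ?_, fun x y z h h' => Subtype.ext ?_, fun x y z h h' => Subtype.ext ?_⟩
    · simp [c, h.1, hnadj y h.2.1]
    · by_contra hne
      obtain ⟨p, hp, hpl⟩ := hnotfar h.2.2
      obtain ⟨q, hq, hql⟩ := hnotfar h'.2.2
      have := hfar' (hleaf y h.2.1 z h'.2.1 (hmem y) (hmem z) hne) (p.reverse.append q)
        (happ (hrev hp) hq)
      simp at this
      omega
    · by_contra hne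
      obtain ⟨p, hp, hpl⟩ := hnotfar h.2.2
      obtain ⟨q, hq, hql⟩ := hnotfar h'.2.2
      have := hnn x y h.1 h'.1 hne (p.append q.reverse) (happ hp (hrev hq))
      simp at this
      omega
  have hmix : ∀ z y, G.Adj e z → y ∈ Y → y ≠ e → IsFar G A' z y (m - 2) := by
    intro z y hz hy hye p hp
    have := hfar e he y hy hye.symm (.cons hz p) (by
      intro v hv
      rw [Walk.support_cons, List.mem_cons] at hv
      rcases hv with rfl | hv
      · exact he.1
      · exact hsub (hp v hv))
    simp at this
    omega
  have hmix' : ∀ z y, G.Adj e z → y ∈ Y → y ≠ e → IsFar G A' z y (m - 1) →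
      IsFar G A' z y (m + 1) := by
    intro z y hz hy hye hF p hp
    obtain ⟨z₀, hz0, hn0⟩ := hstep y hy hye
    obtain ⟨q, hq, hql⟩ := hnotfar hn0
    have hne : z ≠ z₀ := by
      rintro rfl
      exact hn0 hF
    have := hnn z z₀ hz hz0 hne (p.append q.reverse) (happ hp (hrev hq))
    simp at this
    omega
  have ha : ∀ y z : innerBoundary G A', y ≠ z → IsFar G A' y z (m - 2) := by
    intro y z hyz
    have hyz' : (y : V) ≠ z := fun h => hyz (Subtype.ext h)
    rcases hbd y y.2 with h1 | ⟨h1, h1'⟩ <;> rcases hbd z z.2 with h2 | ⟨h2, h2'⟩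
    · exact (hnn y z h1 h2 hyz').mono (by omega)
    · exact hmix y z h1 h2 h2'
    · exact (hmix z y h2 h1 h1').symm
    · exact (hfar' (hleaf y h1 z h2 h1' h2' hyz')).mono (by omega)
  have hb : ∀ y z : innerBoundary G A', y ≠ z → ¬ R y z → ¬ R z y →
      IsFar G A' y z (m + 1) := by
    intro y z hyz hR1 hR2
    have hyz' : (y : V) ≠ z := fun h => hyz (Subtype.ext h)
    rcases hbd y y.2 with h1 | ⟨h1, h1'⟩ <;> rcases hbd z z.2 with h2 | ⟨h2, h2'⟩
    · exact (hnn y z h1 h2 hyz').mono (by omega)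
    · exact hmix' y z h1 h2 h2' (by_contra fun h => hR1 ⟨h1, h2, h⟩)
    · exact (hmix' z y h2 h1 h1' (by_contra fun h => hR2 ⟨h2, h1, h⟩)).symm
    · exact (hfar' (hleaf y h1 z h2 h1' h2' hyz')).mono (by omega)
  have hle : A'.ncard ≤ A.ncard := Set.ncard_le_ncard hsub
  rcases card_le_or_star hG hk (by omega) ⟨m, rfl⟩ (A := A') ⟨f, hf.1, hfe⟩ hS hR ha hb (by omega)
    (by omega) (by omega) with h | ⟨-, s, -, hs⟩
  · omega
  · -- two neighbours of `e` cannot both belong to a star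
    exfalso
    have hw : ∀ x, ∃ w : innerBoundary G A', G.Adj e w ∧ (w : V) ≠ x := by
      intro x
      obtain ⟨w, hwA, hew, hwx⟩ := exists_adj_mem_ne hreg hk hA he.1 x
      exact ⟨⟨w, ⟨hwA, hew.ne'⟩, e, fun h => h.2 rfl, hew.symm⟩, hew, hwx⟩
    by_cases hse : G.Adj e s
    · obtain ⟨w, hew, hws⟩ := hw s
      rcases hs w (fun h => hws (congrArg Subtype.val h)) with h | h
      · exact hnadj w h.2.1 hew
      · exact hnadj s h.2.1 hse
    · obtain ⟨w₁, h1, -⟩ := hw e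
      obtain ⟨w₂, h2, h12⟩ := hw w₁
      have r : ∀ w : innerBoundary G A', G.Adj e w → R w s := fun w hew =>
        (hs w (fun h => hse (h ▸ hew))).resolve_left fun h => hse h.1
      exact h12 (congrArg Subtype.val (hR.left_unique _ _ _ (r w₂ h2) (r w₁ h1)))

end Boundary

/-! ### Sets separated by a girth cycle -/

section Cycle

variable {V : Type*} {G : SimpleGraph V} {A : Set V} {k m : ℕ}

lemma exists_walk_on_cycle {g : ℕ} {c : ZMod g → V} (hadj : ∀ i, G.Adj (c i) (c (i + 1)))
    (i : ZMod g) (d : ℕ) :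
    ∃ p : G.Walk (c i) (c (i + d)), p.length = d ∧ (∀ v ∈ p.support, v ∈ Set.range c) ∧
      ∀ e ∈ p.edges, ∃ j, e = s(c j, c (j + 1)) := by
  induction d with
  | zero =>
    have : c (i + (0 : ℕ)) = c i := by simp
    rw [this]
    exact ⟨.nil, rfl, by simp, by simp⟩
  | succ d ih =>
    obtain ⟨p, hp, hpc, hpe⟩ := ih
    have : c (i + (d + 1 : ℕ)) = c (i + d + 1) := by push_cast; rw [add_assoc]
    rw [this]
    refine ⟨p.concat (hadj _), by simp [hp], fun v hv => ?_, fun e he => ?_⟩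
    · rw [Walk.support_concat, List.mem_append] at hv
      rcases hv with hv | hv
      · exact hpc v hv
      · rw [List.mem_singleton.1 hv]
        exact ⟨_, rfl⟩
    · rw [Walk.edges_concat, List.concat_eq_append, List.mem_append] at he
      rcases he with he | he
      · exact hpe e he
      · exact ⟨_, List.mem_singleton.1 he⟩

/-- A walk inside `A` between neighbours of two vertices of the cycle `c` closes up along `c`. -/
lemma le_length_of_adj_cycle {g d : ℕ} {c : ZMod g → V} (hg : (g : ℕ∞) ≤ G.egirth)
    (hadj : ∀ i, G.Adj (c i) (c (i + 1))) (hAc : ∀ a ∈ A, a ∉ Set.range c)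
    {y z : V} {i j : ZMod g} (hj : j = i + d) (hy : G.Adj y (c i)) (hz : G.Adj z (c j))
    (hne : y = z → c i ≠ c j) (p : G.Walk y z) (hp : ∀ v ∈ p.support, v ∈ A) :
    g ≤ p.length + d + 2 := by
  subst hj
  obtain ⟨q, hq, hqc, -⟩ := exists_walk_on_cycle hadj i d
  have hyA : y ∈ A := hp y p.start_mem_support
  have hzA : z ∈ A := hp z p.end_mem_support
  have := le_length_add_one_of_notMem_edges hg hy.symm
    (p.append (.cons hz q.reverse)) (by
      rw [Walk.edges_append, Walk.edges_cons, Walk.edges_reverse]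
      simp only [List.mem_append, List.mem_cons, List.mem_reverse]
      rintro (h | h | h)
      · exact hAc _ (hp _ (p.fst_mem_support_of_mem_edges h)) ⟨i, rfl⟩
      · rcases Sym2.eq_iff.1 h with e | e
        · exact hAc z hzA ⟨i, e.1⟩
        · exact hne e.2 e.1
      · exact hAc y hyA (hqc y (q.snd_mem_support_of_mem_edges h)))
  simp [hq] at this
  omega

/-- Positions on an odd cycle are at distance at most `m - 1`, or they are antipodal. -/
lemma exists_dist_or_antipodal (hm : 1 ≤ m) (i j : ZMod (2 * m + 1)) :
    (∃ d : ℕ, d ≤ m - 1 ∧ (j = i + d ∨ i = j + d)) ∨ j = i + m ∨ i = j + m := by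
  have h1 : j = i + ((j - i).val : ℕ) := by
    rw [ZMod.natCast_zmod_val]
    ring
  have hlt := (j - i).val_lt
  generalize (j - i).val = d at h1 hlt
  have h2 : i = j + ((2 * m + 1 - d : ℕ) : ZMod (2 * m + 1)) := by
    rw [h1, Nat.cast_sub hlt.le, ZMod.natCast_self]
    ring
  by_cases hd1 : d ≤ m - 1
  · exact Or.inl ⟨d, hd1, Or.inl h1⟩
  by_cases hd2 : d = m
  · exact Or.inr (Or.inl (hd2 ▸ h1))
  by_cases hd3 : d = m + 1
  · right; right
    rwa [show 2 * m + 1 - d = m by omega] at h2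
  · exact Or.inl ⟨_, by omega, Or.inr h2⟩

/-- In a cage of girth `2 * m + 1`, a set whose only outside neighbours lie on a girth cycle `c`
has at least half of the vertices. -/
theorem card_le_of_separated [Fintype V] [G.LocallyFinite] (hm : 2 ≤ m)
    (hG : G.IsCage k (2 * m + 1)) (hk : 3 ≤ k) {c : ZMod (2 * m + 1) → V}
    (hinj : Function.Injective c) (hadj : ∀ i, G.Adj (c i) (c (i + 1)))
    (hne : A.Nonempty) (hAc : ∀ a ∈ A, a ∉ Set.range c)
    (hsep : ∀ a ∈ A, ∀ b, b ∉ A → G.Adj a b → b ∈ Set.range c) :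
    Fintype.card V ≤ 2 * A.ncard := by
  classical
  have hgi : ((2 * m + 1 : ℕ) : ℕ∞) ≤ G.egirth := hG.1.2.ge
  have h2m : (2 * m + 1 : ZMod (2 * m + 1)) = 0 := by
    have := ZMod.natCast_self (2 * m + 1)
    push_cast at this
    exact this
  -- walks inside `A` are bounded below by the distance of their attachments on the cycle
  have hbound : ∀ {y z} {i j : ZMod (2 * m + 1)} {d : ℕ}, (j = i + d ∨ i = j + d) → G.Adj y (c i) → G.Adj z (c j) →
      (y = z → c i ≠ c j) → IsFar G A y z (2 * m - 1 - d) := by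
    intro y z i j d hd hy hz hyz
    rcases hd with hd | hd
    · intro p hp
      have := le_length_of_adj_cycle hgi hadj hAc hd hy hz hyz p hp
      omega
    · apply IsFar.symm
      intro p hp
      have := le_length_of_adj_cycle hgi hadj hAc hd hz hy (fun h h' => hyz h.symm h'.symm) p hp
      omega
  have hbound' : ∀ {y z} {i j : ZMod (2 * m + 1)}, G.Adj y (c i) → G.Adj z (c j) →
      (y = z → c i ≠ c j) → IsFar G A y z (m - 1) := by
    intro y z i j hy hz hyz
    rcases exists_dist_or_antipodal (by omega) i j with ⟨d, hd, h⟩ | h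
    · exact (hbound h hy hz hyz).mono (by omega)
    · exact (hbound h hy hz hyz).mono (by omega)
  have hS : HasSingleExits G A := by
    intro a ha b hb b' hb' hab hab'
    obtain ⟨i, rfl⟩ := hsep a ha b hb hab
    obtain ⟨j, rfl⟩ := hsep a ha b' hb' hab'
    by_contra hij
    have := hbound' hab hab' (fun _ => hij) .nil (by simpa using ha)
    simp at this
    omega
  have hκ : ∀ y : innerBoundary G A, ∃ i, G.Adj y (c i) := by
    rintro ⟨y, hy, b, hb, hyb⟩
    obtain ⟨i, rfl⟩ := hsep y hy b hb hyb
    exact ⟨i, hyb⟩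
  choose κ hκ using hκ
  have hval : ∀ {y z : innerBoundary G A}, y ≠ z → ((y : V) = z → c (κ y) ≠ c (κ z)) :=
    fun hyz h => absurd (Subtype.ext h) hyz
  let R : innerBoundary G A → innerBoundary G A → Prop := fun y z =>
    κ z = κ y + m ∧ ¬ IsFar G A y z m
  have hnotfar : ∀ {y z n}, ¬ IsFar G A y z n →
      ∃ p : G.Walk y z, (∀ v ∈ p.support, v ∈ A) ∧ p.length < n := by
    intro y z n h
    unfold IsFar at h
    push Not at h
    exact h
  have htwo : ∀ {x y z : innerBoundary G A}, κ y = κ z → ¬ IsFar G A x y m →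
      ¬ IsFar G A x z m → y = z := by
    intro x y z hyz hy hz
    by_contra hne
    obtain ⟨p, hp, hpl⟩ := hnotfar hy
    obtain ⟨q, hq, hql⟩ := hnotfar hz
    have := hbound (d := 0) (Or.inl (by simp [hyz])) (hκ y) (hκ z) (hval hne)
      (p.reverse.append q) (by
        intro v hv
        rw [Walk.mem_support_append_iff] at hv
        rcases hv with hv | hv
        · exact hp v (by simpa using hv)
        · exact hq v hv)
    simp at this
    omega
  -- stepping to the antipodal vertex is a rotation of `ZMod (2 * m + 1)` by `m`, which the factor
  -- `-2`, the inverse of `m`, turns into the rotation by one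
  have hR : IsLayered (fun y => -2 * κ y) R := by
    refine ⟨fun x y h => ?_, fun x y z h h' => ?_, fun x y z h h' => ?_⟩
    · rw [h.1]
      linear_combination -h2m
    · exact htwo (h.1.trans h'.1.symm) h.2 h'.2
    · exact htwo (add_right_cancel (h.1.symm.trans h'.1)) (fun hf => h.2 hf.symm)
        (fun hf => h'.2 hf.symm)
  have ha : ∀ y z : innerBoundary G A, y ≠ z → IsFar G A y z (m - 1) := fun y z hyz =>
    hbound' (hκ y) (hκ z) (hval hyz)
  have hb : ∀ y z : innerBoundary G A, y ≠ z → ¬ R y z → ¬ R z y → IsFar G A y z m := by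
    intro y z hyz h1 h2
    rcases exists_dist_or_antipodal (by omega) (κ y) (κ z) with ⟨d, hd, h⟩ | h | h
    · exact (hbound h (hκ y) (hκ z) (hval hyz)).mono (by omega)
    · exact by_contra fun hf => h1 ⟨h, hf⟩
    · exact by_contra fun hf => h2 ⟨h, fun hf' => hf hf'.symm⟩
  rcases card_le_or_star hG hk (by omega) ⟨m, rfl⟩ hne hS hR ha hb (by omega) (by omega)
    (by omega) with h | ⟨h3, e, ⟨f, hfe, -⟩, hstar⟩
  · exact h
  have hfe' : (f : V) ≠ e := fun h => hfe (Subtype.ext h)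
  have hnear : ∀ y ∈ innerBoundary G A, y ≠ e → ¬ IsFar G A e y m := by
    intro y hy hye
    rcases hstar ⟨y, hy⟩ (fun h => hye (congrArg Subtype.val h)) with h | h
    · exact h.2
    · exact fun hf => h.2 hf.symm
  rcases hm.eq_or_lt with rfl | hm3
  · refine card_le_of_boundary_star_of_girth_five hG hk _ A rfl hne hS h3
      ⟨e, e.2, f, f.2, hfe', fun y hy hye => ?_⟩
    obtain ⟨p, -, hp⟩ := hnotfar (hnear y hy hye)
    have : p.length ≠ 0 := fun h0 => hye (Walk.eq_of_length_eq_zero h0).symm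
    exact Walk.adj_of_length_eq_one (p := p) (by omega)
  · refine card_le_of_boundary_star hm3 hG hk hS
      (fun y hy z hz hyz => ha ⟨y, hy⟩ ⟨z, hz⟩ fun h => hyz (congrArg Subtype.val h))
      e.2 f.2 hfe' hnear fun y hy z hz hye hze hyz => ?_
    have hside : ∀ y : innerBoundary G A, (y : V) ≠ e → κ y = κ e + m ∨ κ y = κ e - m := by
      intro y hye
      rcases hstar y (fun h => hye (congrArg Subtype.val h)) with h | h
      · exact Or.inl h.1
      · exact Or.inr (eq_sub_of_add_eq h.1.symm)
    have hyz' : (⟨y, hy⟩ : innerBoundary G A) ≠ ⟨z, hz⟩ := fun h => hyz (congrArg Subtype.val h)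
    -- the two antipodes of a vertex of the cycle are adjacent on it
    obtain ⟨d, hd, h⟩ : ∃ d : ℕ, d ≤ 1 ∧
        (κ ⟨z, hz⟩ = κ ⟨y, hy⟩ + d ∨ κ ⟨y, hy⟩ = κ ⟨z, hz⟩ + d) := by
      rcases hside ⟨y, hy⟩ hye with h1 | h1 <;> rcases hside ⟨z, hz⟩ hze with h2 | h2 <;>
        rw [h1, h2]
      · exact ⟨0, by norm_num, Or.inl (by simp)⟩
      · exact ⟨1, le_rfl, Or.inl (by push_cast; linear_combination -h2m)⟩
      · exact ⟨1, le_rfl, Or.inr (by push_cast; linear_combination -h2m)⟩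
      · exact ⟨0, by norm_num, Or.inl (by simp)⟩
    exact (hbound h (hκ ⟨y, hy⟩) (hκ ⟨z, hz⟩) (hval hyz')).mono (by omega)

lemma exists_parametrization {g : ℕ} (hg : 2 ≤ g) {u : V} (C : G.Walk u u) (hC : C.IsCycle)
    (hlen : C.length = g) : ∃ c : ZMod g → V, Function.Injective c ∧
      (∀ i, G.Adj (c i) (c (i + 1))) ∧ Set.range c = {v | v ∈ C.support} := by
  have : NeZero g := ⟨by omega⟩
  have : Fact (1 < g) := ⟨by omega⟩
  refine ⟨fun i => C.getVert i.val, fun i j hij => ?_, fun i => ?_, ?_⟩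
  · have hi := i.val_lt
    have hj := j.val_lt
    exact ZMod.val_injective g (hC.getVert_injOn' (by simp only [Set.mem_ofPred_eq]; omega)
      (by simp only [Set.mem_ofPred_eq]; omega) hij)
  · have hi := i.val_lt
    have h := C.adj_getVert_succ (i := i.val) (by omega)
    have hv : (i + 1).val = (i.val + 1) % g := by
      rw [ZMod.val_add, ZMod.val_one]
    by_cases hlast : i.val + 1 = g
    · rw [hlast, Nat.mod_self] at hv
      rw [show i.val + 1 = C.length by omega, Walk.getVert_length] at h
      simp only [hv, Walk.getVert_zero]
      exact h
    · rw [Nat.mod_eq_of_lt (by omega)] at hv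
      simp only [hv]
      exact h
  · ext v
    simp only [Set.mem_range, Set.mem_ofPred_eq, Walk.mem_support_iff_exists_getVert]
    constructor
    · rintro ⟨i, rfl⟩
      exact ⟨i.val, rfl, by have := i.val_lt; omega⟩
    · rintro ⟨n, rfl, hn⟩
      by_cases hlast : n = g
      · refine ⟨0, ?_⟩
        rw [hlast, ← hlen, Walk.getVert_length, ZMod.val_zero, Walk.getVert_zero]
      · exact ⟨n, by rw [ZMod.val_cast_of_lt (by omega)]⟩

/-- A girth cycle is chordless, so in a regular graph of degree at least three some vertex lies
off it. -/
lemma exists_notMem_cycle {g : ℕ} (hg4 : 4 ≤ g) (hg : (g : ℕ∞) ≤ G.egirth) (hk : 3 ≤ k)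
    (hreg : IsReg G k) {c : ZMod g → V} (hinj : Function.Injective c)
    (hadj : ∀ i, G.Adj (c i) (c (i + 1))) : ∃ v, v ∉ Set.range c := by
  have : NeZero g := ⟨by omega⟩
  by_contra hcon
  push Not at hcon
  have hsub : G.neighborSet (c 0) ⊆ {c 1, c (-1)} := by
    intro w hw
    obtain ⟨i, rfl⟩ := hcon w
    by_contra hne
    simp only [Set.mem_insert_iff, Set.mem_singleton_iff, not_or, hinj.eq_iff] at hne
    have hwalk := exists_walk_on_cycle hadj 0 i.val
    rw [ZMod.natCast_zmod_val, zero_add] at hwalk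
    obtain ⟨p, hp, -, hpe⟩ := hwalk
    have := le_length_add_one_of_notMem_edges hg hw.symm p (by
      intro he
      obtain ⟨j, hj⟩ := hpe _ he
      rw [Sym2.eq_iff, hinj.eq_iff, hinj.eq_iff, hinj.eq_iff, hinj.eq_iff] at hj
      rcases hj with ⟨rfl, hj⟩ | ⟨rfl, rfl⟩
      · exact hne.2 (eq_neg_of_add_eq_zero_left hj.symm)
      · exact hne.1 (zero_add 1))
    have hlt := i.val_lt
    have hv : i.val + 1 = g := by omega
    apply hne.2
    have h0 : ((i.val + 1 : ℕ) : ZMod g) = 0 := by rw [hv, ZMod.natCast_self]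
    push_cast at h0
    rw [ZMod.natCast_zmod_val] at h0
    exact eq_neg_of_add_eq_zero_left h0
  have h1 := Set.ncard_le_ncard hsub (Set.toFinite _)
  have h2 := Set.ncard_insert_le (c 1) {c (-1)}
  rw [hreg] at h1
  rw [Set.ncard_singleton] at h2
  omega

end Cycle

end CageCycle

open CageCycle SimpleGraph in
theorem theorem4 {V : Type*} [Fintype V] (G : SimpleGraph V) [G.LocallyFinite]
    (k g : ℕ) (hk : 3 ≤ k) (hg : 5 ≤ g) (hodd : Odd g) (hG : G.IsCage k g)
    {u : V} (C : G.Walk u u) (hC : C.IsCycle) (hlen : C.length = g) :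
    C.IsNonseparating := by
  obtain ⟨m, rfl⟩ := hodd
  obtain ⟨c, hinj, hadj, hrange⟩ := exists_parametrization (by omega) C hC hlen
  obtain ⟨v, hv⟩ := exists_notMem_cycle (by omega) hG.1.2.ge hk
    (isReg_of_isRegularOfDegree hG.1.1) hinj hadj
  rw [hrange] at hv
  have hnonempty : Nonempty {v : V | v ∉ C.support} := ⟨⟨v, hv⟩⟩
  refine (connected_iff _).2 ⟨fun a b => by_contra fun hab => ?_, hnonempty⟩
  -- the component of `a` and the rest both have at least half of the vertices
  have key : ∀ S : Set {v : V | v ∉ C.support}, S.Nonempty →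
      (∀ x ∈ S, ∀ y, (G.induce {v : V | v ∉ C.support}).Adj x y → y ∈ S) →
      Fintype.card V ≤ 2 * (Subtype.val '' S).ncard := by
    intro S hS hclosed
    refine card_le_of_separated (by omega) hG hk hinj hadj (hS.image _) ?_ ?_
    · rintro _ ⟨x, -, rfl⟩
      rw [hrange]
      exact x.2
    · rintro _ ⟨x, hx, rfl⟩ y hy hxy
      rw [hrange]
      by_contra hyC
      exact hy ⟨⟨y, hyC⟩, hclosed x hx _ hxy, rfl⟩
  let S : Set {v : V | v ∉ C.support} :=
    {w | (G.induce {v : V | v ∉ C.support}).Reachable a w}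
  have h1 := key S ⟨a, Reachable.refl a⟩ fun x hx y hxy => hx.trans hxy.reachable
  have h2 := key Sᶜ ⟨b, hab⟩ fun x hx y hxy hy => hx (hy.trans hxy.symm.reachable)
  have h3 : (Subtype.val '' S).ncard + (Subtype.val '' Sᶜ).ncard < Fintype.card V := by
    rw [← Set.ncard_union_eq ((Set.disjoint_image_iff Subtype.val_injective).2
      disjoint_compl_right), ← Set.image_union, Set.union_compl_self, ← Nat.card_eq_fintype_card,
      ← Set.ncard_univ]
    refine Set.ncard_lt_ncard ⟨Set.subset_univ _, fun h => ?_⟩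
    obtain ⟨x, -, hx⟩ := h (Set.mem_univ u)
    exact x.2 (by rw [hx]; exact C.start_mem_support)
  omega
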